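/- Let $D\subset\mathbb{R}^d$ be a bounded open set, and let $\rho:D\to[0,\infty)$ be a continuous probability density, i.e. $\int_D\rho(x)\,dx=1$. Let $x_1,x_2,\dots$ be a sequence of distinct points of $D$ whose empirical measures $\frac1n\sum_{i=1}^n\delta_{x_i}$ converge weakly to $\rho(x)\,dx$ as $n\to\infty$. Let $\lambda:\overline D\to(0,\infty)$ and $g:\overline D\to\mathbb{R}$ be continuous. Let $\xi_1,\xi_2,\dots$ be independent, non-negative random variables (not necessarily identically distributed) whose cumulative distribution functions satisfy $F_i(t)=t+O(t^2)$ near zero, uniformly in $i$: there are $C,\delta>0$ with $|F_i(t)-t|\le Ct^2$ for all $i$ and all $t\in[0,\delta]$. Define random functions on $\overline D$ by $$f_n(x)=\begin{cases}\dfrac{n}{\lambda(x_i)}\,\xi_i+g(x_i), & x=x_i,\ i=1,\dots,n,\\ +\infty, & \text{otherwise.}\end{cases}$$ For $f:\overline D\to\mathbb{R}\cup\{+\infty\}$ put $m_1(f)=\inf_{\overline D}f$, $M_1(f)=\{x\in\overline D: f(x)=m_1(f)\}$ and, recursively for $j\ge2$, $m_j(f)=\inf\{f(x):x\in\overline D\setminus\bigcup_{i<j}M_i(f)\}$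 and $M_j(f)=\{x\in\overline D: m_{j-1}(f)<f(x)=m_j(f)\}$. When $M_j(f)$ is a singleton, its element is called the $j$-th argmin of $f$. For an integrable function $\kappa:D\to[0,\infty)$ with $\bar\kappa:=\int_D\kappa(x)\,dx>0$ and a function $h$ on $D$, put $$\mu_\kappa(E)=\frac1{\bar\kappa}\int_E\kappa(x)\,dx,\qquad H_{\kappa,h}(s)=\mu_\kappa(\{x\in D:h(x)\le s\}),$$ $$\Phi(z,h)=\int_{h(z)}^\infty\exp\Big(-\bar\kappa\int_{-\infty}^tH_{\kappa,h}(s)\,ds\Big)dt,\qquad \Psi(z,t,h)=\chi_{\{t>h(z)\}}\exp\Big(-\bar\kappa\int_{-\infty}^tH_{\kappa,h}(s)\,ds\Big),$$ and, for $x_1,\dots,x_k\in D$, let $p_1(x_1)=\kappa(x_1)\,\Phi(x_1,g)$ and, for $k\ge2$, $$p_k(x_1,\dots,x_k)=\Big(\prod_{j=1}^k\kappa(x_j)\Big)\int_{\mathbb{R}^{k-1}}\Phi\big(x_k,(g-r_{k-1})^+\big)\,\Psi(x_1,r_1,g)\prod_{j=2}^{k-1}\Psi\big(x_j,\,r_j-r_{j-1},\,(g-r_{j-1})^+\big)\,dr_1\cdots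 dr_{k-1}.$$ Take $\kappa(x)=\tilde\lambda(x):=\lambda(x)\rho(x)$. Then for every $k\ge1$: 1. the probability that $f_n$ has unique $j$-th argmins for all $j=1,\dots,k$ tends to $1$ as $n\to\infty$; 2. $p_k$ is a probability density on $D^k$ with respect to $dx_1\cdots dx_k$; 3. the joint law of the first $k$ argmins of $f_n$ (each given a fixed arbitrary value on the event that it does not exist or is not unique) converges weakly, as $n\to\infty$, to $p_k(x_1,\dots,x_k)\,dx_1\cdots dx_k$. -/

import Mathlib

open MeasureTheory ProbabilityTheory Filter Topology

noncomputable section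

/-! ### Successive minima and argmins

Indices start at `0`: the `(j+1)`-st minimum `m_{j+1}` and argmin set `M_{j+1}` carry the index `j`. -/

/-- The pair `(m_{j+1}(f), M_1(f) ∪ ⋯ ∪ M_{j+1}(f))` for a function `f` on the set `K`. -/
def minData {E : Type*} (K : Set E) (f : E → EReal) : ℕ → EReal × Set E
  | 0 => (⨅ x ∈ K, f x, {x ∈ K | f x = ⨅ y ∈ K, f y})
  | j + 1 =>
      (⨅ x ∈ K \ (minData K f j).2, f x,
        (minData K f j).2 ∪
          {x ∈ K | (minData K f j).1 < f x ∧ f x = ⨅ y ∈ K \ (minData K f j).2, f y})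

/-- The `(j+1)`-st minimum of `f` on `K`. -/
def kMin {E : Type*} (K : Set E) (f : E → EReal) (j : ℕ) : EReal := (minData K f j).1

/-- The set of `(j+1)`-st argmins of `f` on `K`. -/
def kArgminSet {E : Type*} (K : Set E) (f : E → EReal) : ℕ → Set E
  | 0 => {x ∈ K | f x = kMin K f 0}
  | j + 1 => {x ∈ K | kMin K f j < f x ∧ f x = kMin K f (j + 1)}

theorem minData_snd {E : Type*} (K : Set E) (f : E → EReal) (j : ℕ) :
    (minData K f j).2 = ⋃ i ∈ Set.Iic j, kArgminSet K f i := by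
  induction j with
  | zero => simp [minData, kArgminSet, kMin]
  | succ j ih =>
    have h : Set.Iic (j + 1) = Set.Iic j ∪ {j + 1} := by
      ext i; simp; omega
    rw [h, Set.biUnion_union, ← ih]
    simp [minData, kArgminSet, kMin]

theorem kMin_zero {E : Type*} (K : Set E) (f : E → EReal) :
    kMin K f 0 = ⨅ x ∈ K, f x := rfl

theorem kMin_succ {E : Type*} (K : Set E) (f : E → EReal) (j : ℕ) :
    kMin K f (j + 1) = ⨅ x ∈ K \ ⋃ i ∈ Set.Iic j, kArgminSet K f i, f x := by
  rw [← minData_snd]; rfl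

open Classical in
/-- The `(j+1)`-st argmin of `f` on `K`, when it exists and is unique (otherwise the fixed
value `0`). -/
def kArgmin {E : Type*} [Zero E] (K : Set E) (f : E → EReal) (j : ℕ) : E :=
  if h : ∃ x, kArgminSet K f j = {x} then h.choose else 0

theorem kArgmin_spec {E : Type*} [Zero E] (K : Set E) (f : E → EReal) (j : ℕ)
    (h : ∃ x, kArgminSet K f j = {x}) : kArgminSet K f j = {kArgmin K f j} := by
  rw [kArgmin, dif_pos h]; exact h.choose_spec

/-! ### The random functions `f_n` -/

/-- For distinct points `x 0, x 1, …` and real numbers `ξ 0, ξ 1, …`, the function equal to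
`(n / lam (x i)) * ξ i + g (x i)` at `x i` for `i < n`, and to `+∞` at all other points. -/
def discreteFn {E : Type*} (x : ℕ → E) (lam g : E → ℝ) (n : ℕ) (ξ : ℕ → ℝ) (y : E) : EReal :=
  ⨅ i ∈ {i : ℕ | i < n ∧ x i = y}, (((n : ℝ) / lam (x i) * ξ i + g (x i) : ℝ) : EReal)

theorem discreteFn_apply {E : Type*} {x : ℕ → E} (hx : Function.Injective x) (lam g : E → ℝ)
    (n : ℕ) (ξ : ℕ → ℝ) {i : ℕ} (hi : i < n) :
    discreteFn x lam g n ξ (x i) = (((n : ℝ) / lam (x i) * ξ i + g (x i) : ℝ) : EReal) := by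
  have h : {l : ℕ | l < n ∧ x l = x i} = {i} := by
    ext l
    simp only [Set.mem_ofPred_eq, Set.mem_singleton_iff]
    exact ⟨fun hl => hx hl.2, fun hl => by subst hl; exact ⟨hi, rfl⟩⟩
  simp only [discreteFn, h, Set.mem_singleton_iff, iInf_iInf_eq_left]

theorem discreteFn_eq_top {E : Type*} (x : ℕ → E) (lam g : E → ℝ) (n : ℕ) (ξ : ℕ → ℝ) {y : E}
    (hy : ∀ i < n, x i ≠ y) : discreteFn x lam g n ξ y = ⊤ := by
  simp only [discreteFn, Set.mem_ofPred_eq, iInf_eq_top]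
  exact fun i hi => absurd hi.2 (hy i hi.1)

/-! ### The explicit density -/

section Density

variable {E : Type*} [MeasureSpace E]

/-- `λ̄ = ∫_D λ(x) dx`. -/
def totalRate (D : Set E) (lam : E → ℝ) : ℝ := ∫ x in D, lam x

/-- `μ_λ(A) = (1 / λ̄) ∫_A λ(x) dx`. -/
def rateProb (D : Set E) (lam : E → ℝ) (A : Set E) : ℝ :=
  1 / totalRate D lam * ∫ x in A, lam x

/-- `H_{λ,h}(s) = μ_λ({x ∈ D : h(x) ≤ s})`. -/
def levelCdf (D : Set E) (lam h : E → ℝ) (s : ℝ) : ℝ := rateProb D lam {x ∈ D | h x ≤ s}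

/-- `exp(-λ̄ ∫_{-∞}^t H_{λ,h}(s) ds)`. -/
def survival (D : Set E) (lam h : E → ℝ) (t : ℝ) : ℝ :=
  Real.exp (-totalRate D lam * ∫ s in Set.Iic t, levelCdf D lam h s)

/-- `Φ(z,h) = ∫_{h(z)}^∞ exp(-λ̄ ∫_{-∞}^t H_{λ,h}(s) ds) dt`. -/
def Phi (D : Set E) (lam : E → ℝ) (z : E) (h : E → ℝ) : ℝ :=
  ∫ t in Set.Ioi (h z), survival D lam h t

open Classical in
/-- `Ψ(z,t,h) = χ_{t > h(z)} exp(-λ̄ ∫_{-∞}^t H_{λ,h}(s) ds)`. -/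
def Psi (D : Set E) (lam : E → ℝ) (z : E) (t : ℝ) (h : E → ℝ) : ℝ :=
  if h z < t then survival D lam h t else 0

/-- `(g - r)^+`. -/
def shiftPos (g : E → ℝ) (r : ℝ) : E → ℝ := fun y => max (g y - r) 0

/-- The density of the first `k` argmins with respect to the product of `k` copies of the measure
`λ(x) dx` on `D`. The arguments `x_1, …, x_k` and the integration variables `r_1, …, r_{k-1}` are
indexed from `0`. For `k = 1` there is no integration and the value is `Φ(x_1, g)`. -/
def argminKernel (D : Set E) (lam g : E → ℝ) : (k : ℕ) → (Fin k → E) → ℝ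
  | 0, _ => 1
  | 1, x => Phi D lam (x 0) g
  | l + 2, x =>
      ∫ r : Fin (l + 1) → ℝ,
        Phi D lam (x (Fin.last (l + 1))) (shiftPos g (r (Fin.last l))) *
          Psi D lam (x 0) (r 0) g *
          ∏ j : Fin l, Psi D lam (x j.succ.castSucc) (r j.succ - r j.castSucc)
            (shiftPos g (r j.castSucc))

/-- The density of the first `k` argmins with respect to Lebesgue measure `dx_1 ⋯ dx_k`. -/
def argminDensity (D : Set E) (lam g : E → ℝ) (k : ℕ) (x : Fin k → E) : ℝ :=
  (∏ j : Fin k, lam (x j)) * argminKernel D lam g k x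

/-- The measure on `E^k`, carried by `D^k`, with density `argminDensity` with respect to
`dx_1 ⋯ dx_k`. -/
def argminLaw [SigmaFinite (volume : Measure E)] (D : Set E) (lam g : E → ℝ) (k : ℕ) :
    Measure (Fin k → E) :=
  ((volume : Measure (Fin k → E)).restrict (Set.univ.pi fun _ => D)).withDensity
    fun x => ENNReal.ofReal (argminDensity D lam g k x)

end Density

end

/-! Write T_i = n ξ_i / λ(x_i) + g(x_i) for the height of x_i, and ν for the measure κ(y) dy on D. A
height T_i is at most t with probability about λ(x_i) (t - g(x_i))^+ / n. Hence the mean measure of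
the points (x_i, T_i) approaches M = ν(dy) dt on {t > g(y)} (`heightMeasure`), and the probability
that all heights exceed t approaches exp(-Λ(t)), where Λ(t) = ∫ (t - g)^+ dν (`cumRate`). As for a
Poisson process of intensity M, the k lowest points should have density exp(-Λ(t_k)) on {t_1 < ... <
t_k} with respect to M^k. Integrating out the heights leaves p_k, because the factors Φ and Ψ
telescope (`argminKernel_succ_succ`, `argminLaw_apply`).

No convergence of point processes is needed, only lower bounds. For distinct indices, independence
expresses the probability that the corresponding points are the lowest ones as an integral.
Inserting the survival factors of the chosen points themselves only lowers it, and lets the sum over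
all index tuples become one integral against a power of the mean measure
(`setLIntegral_prod_le_iUnion_lowestEvent`). These powers are asymptotically bounded below on open
sets (`pi_measure_le_liminf`), and the survival probability is bounded below uniformly
(`eventually_le_prod_measure_pointHeight`). The outcome is `argminLaw_le_liminf`: for open U, the
liminf of the probability that the argmins are unique and lie in U is at least the mass that p_k
gives to U.

Nothing is lost in this bound because p_k has total mass one. Indeed Λ has right derivative ν{g ≤
t}, so integrating exp(-Λ) against M over heights above r gives exp(-Λ(r)); peeling off the highest
point repeatedly gives 1 (`lintegral_pi_heightMeasure_eq_one`). Taking U to be the whole space now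
yields existence and uniqueness, and the bounds for all open U are the portmanteau criterion for
weak convergence. -/

open scoped ENNReal BoundedContinuousFunction

/-! ### Successive argmins of functions with finitely many finite values -/

section Deterministic

variable {E : Type*} {K : Set E} {F : E → EReal}

/-- The set `C` is left general so that one statement serves the first minimum, with `C = ∅`, and
the later ones, with `C` the union of the earlier argmin sets. -/
theorem iInf_diff_eq_of_strictMono {k : ℕ} {y : Fin k → E} (hyK : ∀ j, y j ∈ K)
    (hmono : StrictMono fun j => F (y j))
    (hrest : ∀ z ∈ K, (∀ j, z ≠ y j) → ∀ j, F (y j) < F z)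
    (j : Fin k) {C : Set E} (hC : ∀ i, y i ∈ C ↔ i < j) :
    ⨅ z ∈ K \ C, F z = F (y j) := by
  refine le_antisymm (iInf₂_le _ ⟨hyK j, fun h => lt_irrefl _ ((hC j).1 h)⟩) (le_iInf₂ ?_)
  rintro z ⟨hzK, hzC⟩
  by_cases hz : ∀ i, z ≠ y i
  · exact (hrest z hzK hz j).le
  · push Not at hz
    obtain ⟨i, rfl⟩ := hz
    exact hmono.monotone (not_lt.1 fun h => hzC ((hC i).2 h))

/-- If `y 0, …, y (k - 1)` are listed by strictly increasing values of `F`, and `F` is larger at all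
other points, then they are the first `k` argmins. -/
theorem kArgminSet_eq_singleton {k : ℕ} {y : Fin k → E} (hyK : ∀ j, y j ∈ K)
    (hmono : StrictMono fun j => F (y j))
    (hrest : ∀ z ∈ K, (∀ j, z ≠ y j) → ∀ j, F (y j) < F z) (j : Fin k) :
    kArgminSet K F j = {y j} := by
  have hinj : ∀ {a b : Fin k}, y a = y b ↔ a = b := fun {a b} =>
    ⟨fun h => hmono.injective (by simp [h]), fun h => by rw [h]⟩
  -- The set excluded in the definition of a minimum involves all earlier argmin sets, so minima and
  -- argmin sets are determined together by strong induction.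
  suffices H : ∀ (m : ℕ) (hm : m < k), kMin K F m = F (y ⟨m, hm⟩) ∧
      kArgminSet K F m = {y ⟨m, hm⟩} from (H j j.2).2
  intro m
  induction m using Nat.strong_induction_on with
  | _ m ih =>
    intro hm
    have hval : kMin K F m = F (y ⟨m, hm⟩) := by
      cases m with
      | zero =>
        rw [kMin_zero, ← iInf_diff_eq_of_strictMono hyK hmono hrest ⟨0, hm⟩ (C := ∅)
          (fun i => by simp [Fin.lt_def]), Set.sdiff_empty]
      | succ m =>
        rw [kMin_succ]
        refine iInf_diff_eq_of_strictMono hyK hmono hrest _ fun i => ?_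
        simp only [Set.mem_iUnion, Set.mem_Iic, exists_prop]
        constructor
        · rintro ⟨l, hl, hmem⟩
          rw [(ih l (by omega) (by omega)).2, Set.mem_singleton_iff, hinj] at hmem
          subst hmem
          simp only [Fin.lt_def]; omega
        · intro h
          simp only [Fin.lt_def] at h
          exact ⟨i, by omega, by rw [(ih i (by omega) (by omega)).2]; rfl⟩
    refine ⟨hval, ?_⟩
    have key : ∀ z ∈ K, F z = F (y ⟨m, hm⟩) → z = y ⟨m, hm⟩ := by
      intro z hz hFz
      by_cases h : ∀ i, z ≠ y i
      · exact absurd hFz (hrest z hz h _).ne'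
      · push Not at h
        obtain ⟨i, rfl⟩ := h
        rw [hmono.injective hFz]
    ext z
    cases m with
    | zero =>
      simp only [kArgminSet, Set.mem_ofPred_eq, Set.mem_singleton_iff, hval]
      exact ⟨fun h => key z h.1 h.2, by rintro rfl; exact ⟨hyK _, rfl⟩⟩
    | succ m =>
      simp only [kArgminSet, Set.mem_ofPred_eq, Set.mem_singleton_iff, hval,
        (ih m (by omega) (by omega)).1]
      refine ⟨fun h => key z h.1 h.2.2, ?_⟩
      rintro rfl
      exact ⟨hyK _, hmono (by simp [Fin.lt_def]), rfl⟩

end Deterministic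

/-! ### Measurability of the argmins -/

section Measurability

variable {E Ω : Type*} [MeasurableSpace Ω] {K : Set E} {F : Ω → E → EReal} {s : Finset E}

/-- An infimum over a possibly uncountable set that varies with ω becomes a finite infimum whose
terms depend measurably on ω. -/
theorem iInf_diff_eq_finset {f : E → EReal} (hs : ∀ z ∈ s, z ∈ K) (hf : ∀ z, z ∉ s → f z = ⊤)
    (C : Set E) [DecidablePred (· ∈ C)] :
    ⨅ z ∈ K \ C, f z = ⨅ z ∈ s, if z ∈ C then ⊤ else f z := by
  refine le_antisymm (le_iInf₂ fun z hz => ?_) (le_iInf₂ ?_)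
  · split_ifs with h
    · exact le_top
    · exact iInf₂_le z ⟨hs z hz, h⟩
  · rintro z ⟨hzK, hzC⟩
    by_cases hz : z ∈ s
    · exact (iInf₂_le z hz).trans (by simp [hzC])
    · simp [hf z hz]

theorem measurable_kMin_and_kArgminSet (hs : ∀ z ∈ s, z ∈ K)
    (hF : ∀ ω z, z ∉ s → F ω z = ⊤) (hmeas : ∀ z, Measurable fun ω => F ω z) (j : ℕ) :
    (Measurable fun ω => kMin K (F ω) j) ∧
      ∀ z, MeasurableSet {ω | z ∈ kArgminSet K (F ω) j} := by
  classical
  induction j using Nat.strong_induction_on with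
  | _ j ih =>
    have hval : Measurable fun ω => kMin K (F ω) j := by
      cases j with
      | zero =>
        have : (fun ω => kMin K (F ω) 0) = fun ω => ⨅ z ∈ s, F ω z := by
          ext ω
          have := iInf_diff_eq_finset hs (hF ω) ∅
          simpa [kMin_zero] using this
        rw [this]
        exact Measurable.biInf _ s.countable_toSet fun z _ => hmeas z
      | succ j =>
        have : (fun ω => kMin K (F ω) (j + 1)) = fun ω => ⨅ z ∈ s,
            if z ∈ ⋃ i ∈ Set.Iic j, kArgminSet K (F ω) i then ⊤ else F ω z := by
          ext ω
          rw [kMin_succ]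
          exact iInf_diff_eq_finset hs (hF ω) _
        rw [this]
        refine Measurable.biInf _ s.countable_toSet fun z _ => ?_
        refine Measurable.ite ?_ measurable_const (hmeas z)
        have : {ω | z ∈ ⋃ i ∈ Set.Iic j, kArgminSet K (F ω) i} =
            ⋃ i ∈ Set.Iic j, {ω | z ∈ kArgminSet K (F ω) i} := by
          ext ω; simp
        rw [this]
        exact MeasurableSet.biUnion (Set.to_countable _) fun i hi =>
          (ih i (Nat.lt_succ_of_le hi)).2 z
    refine ⟨hval, fun z => ?_⟩
    by_cases hzK : z ∈ K
    · cases j with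
      | zero =>
        simp only [kArgminSet, Set.mem_ofPred_eq, hzK, true_and]
        exact measurableSet_eq_fun (hmeas z) hval
      | succ j =>
        simp only [kArgminSet, Set.mem_ofPred_eq, hzK, true_and]
        exact (measurableSet_lt (ih j (Nat.lt_succ_self j)).1 (hmeas z)).inter
          (measurableSet_eq_fun (hmeas z) hval)
    · cases j <;> simp [kArgminSet, hzK]

/-- Argmin sets are level sets in `K`. In particular all points of `K` with value `⊤` enter or stay
out together. -/
theorem kArgminSet_congr_of_eq {f : E → EReal} {y z : E} (hy : y ∈ K) (hz : z ∈ K)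
    (h : f y = f z) (j : ℕ) : y ∈ kArgminSet K f j ↔ z ∈ kArgminSet K f j := by
  cases j <;> simp [kArgminSet, hy, hz, h]

/-- All points of `K` outside `s` carry the value `⊤`. Membership of `u` therefore decides for all
of them, and the presence of a second such point `v` prevents an argmin set from being a singleton
outside `s`. Uniqueness thus becomes a finite Boolean combination of measurable events. -/
theorem measurable_kArgmin [Zero E] [MeasurableSpace E] (hs : ∀ z ∈ s, z ∈ K)
    (hF : ∀ ω z, z ∉ s → F ω z = ⊤) (hmeas : ∀ z, Measurable fun ω => F ω z)
    {u v : E} (huv : u ≠ v) (hu : u ∈ K \ s) (hv : v ∈ K \ s) (j : ℕ) :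
    Measurable fun ω => kArgmin K (F ω) j := by
  classical
  have hset := (measurable_kMin_and_kArgminSet hs hF hmeas j).2
  have hsub : ∀ ω z, z ∈ kArgminSet K (F ω) j → z ∈ K := by
    intro ω z hz
    cases j
    · exact hz.1
    · exact hz.1
  have hsing : ∀ ω z, z ∈ s → (kArgminSet K (F ω) j = {z} ↔ z ∈ kArgminSet K (F ω) j ∧
      (∀ y ∈ s, y ≠ z → y ∉ kArgminSet K (F ω) j) ∧ u ∉ kArgminSet K (F ω) j) := by
    intro ω z hz
    constructor
    · intro h
      rw [h]
      refine ⟨rfl, fun y _ hy => hy, ?_⟩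
      rintro rfl
      exact hu.2 hz
    · rintro ⟨h1, h2, h3⟩
      refine Set.eq_singleton_iff_unique_mem.2 ⟨h1, fun y hy => ?_⟩
      by_contra hne
      by_cases hys : y ∈ s
      · exact h2 y hys hne hy
      · exact h3 ((kArgminSet_congr_of_eq (hsub ω y hy) hu.1
          (by rw [hF ω y hys, hF ω u hu.2]) j).1 hy)
  have hex : ∀ ω, (∃ z, kArgminSet K (F ω) j = {z}) →
      ∃ z ∈ s, kArgminSet K (F ω) j = {z} := by
    rintro ω ⟨z, hz⟩
    refine ⟨z, ?_, hz⟩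
    by_contra hzs
    have hzK : z ∈ kArgminSet K (F ω) j := by rw [hz]; rfl
    have h : ∀ w ∈ K \ (s : Set E), w = z := by
      intro w hw
      have := (kArgminSet_congr_of_eq hw.1 (hsub ω z hzK)
        (by rw [hF ω z hzs, hF ω w hw.2]) j).2 hzK
      rwa [hz] at this
    exact huv ((h u hu).trans (h v hv).symm)
  have hA : ∀ z ∈ s, MeasurableSet {ω | kArgminSet K (F ω) j = {z}} := by
    intro z hz
    simp only [hsing _ z hz]
    refine (hset z).inter (MeasurableSet.inter ?_ (hset u).compl)
    change MeasurableSet {ω | ∀ y ∈ s, y ≠ z → y ∉ kArgminSet K (F ω) j}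
    simp only [Set.ofPred_forall]
    exact Finset.measurableSet_biInter s fun y _ => MeasurableSet.iInter fun _ => (hset y).compl
  -- The argmin takes values in the finite set `s ∪ {0}`, so even preimages of non-measurable sets
  -- are finite unions of measurable events.
  intro B _
  have hdec : (fun ω => kArgmin K (F ω) j) ⁻¹' B =
      (⋃ z ∈ s, {ω | kArgminSet K (F ω) j = {z} ∧ z ∈ B}) ∪
        {ω | (0 : E) ∈ B ∧ ω ∉ ⋃ z ∈ s, {ω | kArgminSet K (F ω) j = {z}}} := by
    ext ω
    simp only [Set.mem_preimage, Set.mem_union, Set.mem_iUnion, Set.mem_ofPred_eq, exists_prop]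
    by_cases h : ∃ z, kArgminSet K (F ω) j = {z}
    · have hspec := kArgmin_spec K (F ω) j h
      obtain ⟨z, hz, hzeq⟩ := hex ω h
      have : z = kArgmin K (F ω) j := Set.singleton_injective (hzeq.symm.trans hspec)
      constructor
      · intro hB
        exact Or.inl ⟨z, hz, hzeq, this ▸ hB⟩
      · rintro (⟨w, _, hw, hB⟩ | ⟨_, hn⟩)
        · rwa [← Set.singleton_injective (hw.symm.trans hspec)]
        · exact absurd ⟨z, hz, hzeq⟩ hn
    · rw [kArgmin, dif_neg h]
      constructor
      · intro hB
        exact Or.inr ⟨hB, fun ⟨z, _, hz⟩ => h ⟨z, hz⟩⟩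
      · rintro (⟨w, _, hw, hB⟩ | ⟨hB, _⟩)
        · exact absurd ⟨w, hw⟩ h
        · exact hB
  rw [hdec]
  refine MeasurableSet.union (Finset.measurableSet_biUnion s fun z hz => ?_) ?_
  · exact (hA z hz).inter (MeasurableSet.const _)
  · exact (MeasurableSet.const _).inter (Finset.measurableSet_biUnion s hA).compl

end Measurability

/-! ### Lowest points of an independent family -/

/-- On rectangles this is the distributive law. It expands a power of the mean measure of the points
into a sum over index tuples. -/
theorem pi_sum_eq_sum_pi {k ι α : Type*} [Fintype k] [DecidableEq k] [Fintype ι]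
    [MeasurableSpace α] (μ : ι → Measure α) [∀ i, IsFiniteMeasure (μ i)] :
    Measure.pi (fun _ : k => ∑ i, μ i) = ∑ f : k → ι, Measure.pi (fun j => μ (f j)) := by
  classical
  refine Measure.pi_eq fun s _ => ?_
  simp only [Measure.coe_finsetSum, Finset.sum_apply, Measure.pi_pi]
  rw [Finset.prod_univ_sum]
  simp

/-- The event that `Z ∘ f` lies in `W` and that all other `Z l` are higher than `Z (f (last))`. -/
def lowestEvent {α Ω : Type*} {n m : ℕ} (h : α → ℝ) (Z : Fin n → Ω → α)
    (W : Set (Fin (m + 1) → α)) (f : Fin (m + 1) → Fin n) : Set Ω :=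
  {ω | (fun j => Z (f j) ω) ∈ W ∧ ∀ l, (∀ j, l ≠ f j) → h (Z (f (Fin.last m)) ω) < h (Z l ω)}

section

variable {α Ω : Type*} [MeasurableSpace α] [MeasurableSpace Ω] {P : Measure Ω}
  {n m : ℕ} {h : α → ℝ} {Z : Fin n → Ω → α} {W : Set (Fin (m + 1) → α)}

theorem measurableSet_lowestEvent (hh : Measurable h) (hZ : ∀ i, Measurable (Z i))
    (hW : MeasurableSet W) (f : Fin (m + 1) → Fin n) :
    MeasurableSet (lowestEvent h Z W f) := by
  refine (hW.preimage (measurable_pi_lambda _ fun j => hZ (f j))).inter ?_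
  change MeasurableSet {ω | ∀ l, (∀ j, l ≠ f j) → h (Z (f (Fin.last m)) ω) < h (Z l ω)}
  simp only [Set.ofPred_forall]
  exact MeasurableSet.iInter fun l => MeasurableSet.iInter fun _ =>
    measurableSet_lt (hh.comp (hZ _)) (hh.comp (hZ _))

/-- Conditionally on the chosen points, the others are independent and must all be higher, which
gives a product over the unchosen indices. Extending the product to all indices inserts factors at
most one; the gain is an integrand that no longer depends on `f`. -/
theorem setLIntegral_prod_le_lowestEvent [IsProbabilityMeasure P] (hh : Measurable h)
    (hZ : ∀ i, Measurable (Z i)) (hind : iIndepFun Z P) (hW : MeasurableSet W)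
    {f : Fin (m + 1) → Fin n} (hf : Function.Injective f) :
    ∫⁻ z in W, ∏ l, P {ω | h (z (Fin.last m)) < h (Z l ω)}
        ∂(Measure.pi fun j => P.map (Z (f j))) ≤ P (lowestEvent h Z W f) := by
  classical
  set S : Finset (Fin n) := Finset.univ.image f with hS
  set X : Ω → Fin (m + 1) → α := fun ω j => Z (f j) ω with hX
  set Y : Ω → (↥(Sᶜ) → α) := fun ω l => Z l ω with hY
  have hXm : Measurable X := measurable_pi_lambda _ fun j => hZ (f j)
  have hYm : Measurable Y := measurable_pi_lambda _ fun j => hZ j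
  have hXY : IndepFun X Y P := by
    have h1 := hind.indepFun_finset S Sᶜ disjoint_compl_right hZ
    have hmem : ∀ j, f j ∈ S := fun j => Finset.mem_image_of_mem _ (Finset.mem_univ j)
    have h2 : Measurable fun (v : ↥S → α) (j : Fin (m + 1)) => v ⟨f j, hmem j⟩ :=
      measurable_pi_lambda _ fun j => measurable_pi_apply _
    exact h1.comp h2 measurable_id
  have hmapX : P.map X = Measure.pi fun j => P.map (Z (f j)) :=
    (iIndepFun_iff_map_fun_eq_pi_map fun j => (hZ (f j)).aemeasurable).1 (hind.precomp hf)
  have hprod := (indepFun_iff_map_prod_eq_prod_map_map hXm.aemeasurable hYm.aemeasurable).1 hXY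
  set A : Set ((Fin (m + 1) → α) × (↥(Sᶜ) → α)) :=
    {p | p.1 ∈ W ∧ ∀ l, h (p.1 (Fin.last m)) < h (p.2 l)} with hA
  have hAm : MeasurableSet A := by
    refine (hW.preimage measurable_fst).inter ?_
    change MeasurableSet {p : (Fin (m + 1) → α) × (↥(Sᶜ) → α) |
      ∀ l, h (p.1 (Fin.last m)) < h (p.2 l)}
    simp only [Set.ofPred_forall]
    refine MeasurableSet.iInter fun l => measurableSet_lt ?_ ?_
    · exact hh.comp ((measurable_pi_apply _).comp measurable_fst)
    · exact hh.comp ((measurable_pi_apply _).comp measurable_snd)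
  have hev : lowestEvent h Z W f = (fun ω => (X ω, Y ω)) ⁻¹' A := by
    ext ω
    simp only [lowestEvent, hA, hX, hY, Set.mem_ofPred_eq, Set.mem_preimage, Subtype.forall]
    refine and_congr_right fun _ => forall_congr' fun l => ?_
    simp [hS, eq_comm]
  rw [hev, ← Measure.map_apply (hXm.prodMk hYm) hAm, hprod, Measure.prod_apply hAm, hmapX,
    ← lintegral_indicator hW]
  refine lintegral_mono fun z => ?_
  by_cases hz : z ∈ W
  · rw [Set.indicator_of_mem hz]
    have hmeasl : ∀ l, MeasurableSet {ω | h (z (Fin.last m)) < h (Z l ω)} := fun l =>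
      measurableSet_lt measurable_const (hh.comp (hZ l))
    have hsec : P.map Y (Prod.mk z ⁻¹' A) =
        ∏ l ∈ Sᶜ, P {ω | h (z (Fin.last m)) < h (Z l ω)} := by
      rw [Measure.map_apply hYm (hAm.preimage measurable_prodMk_left)]
      have : Y ⁻¹' (Prod.mk z ⁻¹' A) =
          ⋂ l ∈ Sᶜ, Z l ⁻¹' {a | h (z (Fin.last m)) < h a} := by
        ext ω
        simp [hA, hY, hz]
      rw [this, hind.measure_inter_preimage_eq_mul Sᶜ
        (sets := fun _ => {a | h (z (Fin.last m)) < h a})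
        (fun l _ => measurableSet_lt measurable_const hh)]
      rfl
    rw [hsec]
    exact Finset.prod_le_prod_of_subset_of_le_one' (Finset.subset_univ _)
      fun l _ _ => prob_le_one
  · rw [Set.indicator_of_notMem hz]
    exact zero_le

end

/-- Both tuples list the successive argmins of `t` on `Fin n`. Consequently the events for different
tuples are disjoint and their probabilities add up. -/
theorem eq_of_strictMono_of_lt {n m : ℕ} {t : Fin n → ℝ} {f f' : Fin (m + 1) → Fin n}
    (hf : StrictMono fun j => t (f j)) (hf' : StrictMono fun j => t (f' j))
    (hr : ∀ l, (∀ j, l ≠ f j) → t (f (Fin.last m)) < t l)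
    (hr' : ∀ l, (∀ j, l ≠ f' j) → t (f' (Fin.last m)) < t l) : f = f' := by
  have key : ∀ {e : Fin (m + 1) → Fin n}, (StrictMono fun j => t (e j)) →
      (∀ l, (∀ j, l ≠ e j) → t (e (Fin.last m)) < t l) → ∀ j : Fin (m + 1),
      kArgminSet Set.univ (fun l => ((t l : ℝ) : EReal)) j = {e j} := by
    intro e he hre
    refine kArgminSet_eq_singleton (fun _ => Set.mem_univ _)
      (fun a b hab => EReal.coe_lt_coe_iff.2 (he hab)) fun z _ hz j =>
      EReal.coe_lt_coe_iff.2 (lt_of_le_of_lt ?_ (hre z hz))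
    exact he.monotone (Fin.le_last j)
  funext j
  exact Set.singleton_injective ((key hf hr j).symm.trans (key hf' hr' j))

theorem setLIntegral_prod_le_iUnion_lowestEvent {E Ω : Type*} [MeasurableSpace E]
    [MeasurableSingletonClass E] [MeasurableSpace Ω] {P : Measure Ω} [IsProbabilityMeasure P]
    {n m : ℕ} {x : Fin n → E} {T : Fin n → Ω → ℝ} (hT : ∀ i, Measurable (T i))
    (hind : iIndepFun T P) {W : Set (Fin (m + 1) → E × ℝ)} (hW : MeasurableSet W)
    (hW_inj : ∀ z ∈ W, Function.Injective fun j => (z j).1)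
    (hW_mono : ∀ z ∈ W, StrictMono fun j => (z j).2) :
    ∫⁻ z in W, ∏ l, P {ω | (z (Fin.last m)).2 < T l ω}
        ∂(Measure.pi fun _ => ∑ i, P.map fun ω => (x i, T i ω)) ≤
      P (⋃ f, lowestEvent Prod.snd (fun i ω => (x i, T i ω)) W f) := by
  classical
  set Z : Fin n → Ω → E × ℝ := fun i ω => (x i, T i ω) with hZdef
  have hZ : ∀ i, Measurable (Z i) := fun i => measurable_const.prodMk (hT i)
  have hindZ : iIndepFun Z P :=
    hind.comp (fun i t => (x i, t)) fun i => measurable_const.prodMk measurable_id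
  have : ∀ i, IsFiniteMeasure (P.map (Z i)) := fun i => inferInstance
  have hdisj : Pairwise fun f f' =>
      Disjoint (lowestEvent Prod.snd Z W f) (lowestEvent Prod.snd Z W f') := by
    intro f f' hne
    rw [Set.disjoint_left]
    rintro ω ⟨h1, h2⟩ ⟨h1', h2'⟩
    exact hne (eq_of_strictMono_of_lt (t := fun i => T i ω) (hW_mono _ h1) (hW_mono _ h1') h2 h2')
  have hres : ∀ ν : (Fin (m + 1) → Fin n) → Measure (Fin (m + 1) → E × ℝ),
      (∑ f, ν f).restrict W = ∑ f, (ν f).restrict W := fun ν =>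
    map_sum (Measure.restrictₗ W) ν Finset.univ
  rw [pi_sum_eq_sum_pi, hres, lintegral_finsetSum_measure, measure_iUnion hdisj
    fun f => measurableSet_lowestEvent measurable_snd hZ hW f, tsum_fintype]
  refine Finset.sum_le_sum fun f _ => ?_
  by_cases hf : Function.Injective f
  · exact setLIntegral_prod_le_lowestEvent measurable_snd hZ hindZ hW hf
  -- A tuple with a repeated index puts all its mass where two positions coincide, and `W` contains
  -- no such point.
  · have h0 : Measure.pi (fun j => P.map (Z (f j))) W = 0 := by
      have hae : ∀ᵐ z ∂(Measure.pi fun j => P.map (Z (f j))), ∀ j, (z j).1 = x (f j) := by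
        rw [ae_all_iff]
        intro j
        refine (Measure.quasiMeasurePreserving_eval (fun j => P.map (Z (f j))) j).ae
          (p := fun a => a.1 = x (f j)) ?_
        exact (ae_map_iff (hZ _).aemeasurable (p := fun a => a.1 = x (f j))
          (measurable_fst (measurableSet_singleton _))).2 (Eventually.of_forall fun ω => rfl)
      refine measure_mono_null (fun z hz => ?_) (ae_iff.1 hae)
      intro hcon
      refine hf fun a b hab => hW_inj z hz ?_
      simp only [hcon, hab]
    rw [Measure.restrict_eq_zero.2 h0]
    simp

/-! ### Convergence on boxes and open sets -/

/-- A sequence of measures converging on a π-system of sets of finite measure which contains small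
neighbourhoods of all points is asymptotically bounded below on open sets. -/
theorem measure_le_liminf_of_isPiSystem {X : Type*} [MeasurableSpace X] [TopologicalSpace X]
    [SecondCountableTopology X] {S : Set (Set X)} (hS : IsPiSystem S)
    {μ : ℕ → Measure X} {ν : Measure X} (hmeas : ∀ s ∈ S, MeasurableSet s)
    (hν : ∀ s ∈ S, ν s ≠ ∞) (hμ : ∀ s ∈ S, ∀ i, μ i s ≠ ∞)
    (hnhds : ∀ u : Set X, IsOpen u → ∀ x ∈ u, ∃ s ∈ S, s ∈ 𝓝 x ∧ s ⊆ u)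
    (hlim : ∀ s ∈ S, Tendsto (fun i => (μ i).real s) atTop (𝓝 (ν.real s)))
    {G : Set X} (hG : IsOpen G) : ν G ≤ liminf (fun i => μ i G) atTop := by
  refine (le_liminf_iff (by isBoundedDefault) (by isBoundedDefault)).2 fun r hr => ?_
  -- By second countability, countably many members of `S` fill up `G`; finitely many of them
  -- already carry more mass than `r`.
  obtain ⟨T, TS, T_count, hT⟩ : ∃ T : Set (Set X), T ⊆ S ∧ T.Countable ∧ ⋃ t ∈ T, t = G := by
    have : ∀ (x : G), ∃ s ∈ S, s ∈ 𝓝 (x : X) ∧ s ⊆ G := fun x ↦ hnhds G hG x x.2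
    choose! s hsS hs_nhds hsG using this
    rcases TopologicalSpace.isOpen_iUnion_countable (fun i ↦ interior (s i))
      (fun i ↦ isOpen_interior) with ⟨T₀, T₀_count, hT₀⟩
    refine ⟨s '' T₀, by grind, T₀_count.image s, ?_⟩
    refine Set.Subset.antisymm (by simp; grind) ?_
    have : G ⊆ ⋃ i, interior (s i) := by
      intro y hy
      simpa using ⟨y, hy, mem_interior_iff_mem_nhds.2 (hs_nhds ⟨y, hy⟩)⟩
    apply this.trans
    rw [← hT₀, Set.biUnion_image]
    exact Set.iUnion₂_mono fun i j ↦ interior_subset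
  have hne : T.Nonempty := by
    contrapose! hr
    simp [← hT, hr]
  rcases T_count.exists_eq_range hne with ⟨f, hf⟩
  have G_eq : G = ⋃ n, f n := by simp [← hT, hf]
  have hacc : Tendsto (fun i ↦ ν (Set.accumulate f i)) atTop (𝓝 (ν (⋃ i, f i))) :=
    tendsto_measure_iUnion_accumulate
  rw [← G_eq] at hacc
  obtain ⟨N, hN⟩ := ((tendsto_order.1 hacc).1 r hr).exists
  set U : Finset (Set X) := (Finset.range (N + 1)).image f with hU
  have hUS : ∀ s ∈ U, s ∈ S := by
    intro s hs
    obtain ⟨i, _, rfl⟩ := Finset.mem_image.1 hs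
    exact TS (hf ▸ Set.mem_range_self i)
  have hUG : ⋃ s ∈ U, s ⊆ G := by
    simpa [G_eq, hU] using fun i _ ↦ Set.subset_iUnion f i
  have hUν : r < ν (⋃ s ∈ U, s) := by
    convert! hN
    simp [hU, Set.accumulate_def]
  have hfin : ∀ {η : Measure X}, (∀ s ∈ S, η s ≠ ∞) → η (⋃ s ∈ U, s) ≠ ∞ := fun {η} h =>
    ((measure_biUnion_finset_le U _).trans_lt
      (ENNReal.sum_lt_top.2 fun s hs => (h s (hUS s hs)).lt_top)).ne
  -- Convergence passes from a π-system to finite unions by inclusion-exclusion, which is where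
  -- finiteness of the measures matters.
  have hconv := hS.tendsto_measureReal_biUnion hUS hmeas hlim hν hμ
  have hrt : r ≠ ∞ := (hUν.trans (hfin hν).lt_top).ne
  have hr' : r.toReal < ν.real (⋃ s ∈ U, s) :=
    (ENNReal.toReal_lt_toReal hrt (hfin hν)).2 hUν
  filter_upwards [(tendsto_order.1 hconv).1 _ hr'] with i hi
  exact ((ENNReal.toReal_lt_toReal hrt (hfin fun s hs => hμ s hs i)).1 hi).trans_le
    (measure_mono hUG)

/-- The bound `min a b` in place of `a` keeps the identity valid for `b < a`, when the interval is
empty. -/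
theorem measureReal_prod_Ioc {E : Type*} [MeasurableSpace E] {M : Measure (E × ℝ)} {A : Set E}
    (hA : MeasurableSet A) (hM : ∀ b, M (A ×ˢ Set.Iic b) ≠ ∞) (a b : ℝ) :
    M.real (A ×ˢ Set.Ioc a b) = M.real (A ×ˢ Set.Iic b) - M.real (A ×ˢ Set.Iic (min a b)) := by
  have h : A ×ˢ Set.Ioc a b = (A ×ˢ Set.Iic b) \ (A ×ˢ Set.Iic (min a b)) := by
    ext ⟨y, t⟩
    simp only [Set.mem_prod, Set.mem_Ioc, Set.mem_sdiff, Set.mem_Iic, le_min_iff]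
    grind
  rw [h]
  exact measureReal_sdiff (Set.prod_mono_right (Set.Iic_subset_Iic.2 (min_le_right _ _)))
    (hA.prod measurableSet_Iic) (h₁ := hM b)

/-- Convergence on the sets `A ×ˢ Iic b` implies asymptotic lower bounds for finite powers on open
sets. -/
theorem pi_measure_le_liminf {E : Type*} [PseudoMetricSpace E] [SecondCountableTopology E]
    [MeasurableSpace E] [BorelSpace E] {k : ℕ} (η : Measure E) [SFinite η]
    {μ : ℕ → Measure (E × ℝ)} {M : Measure (E × ℝ)} [∀ n, SigmaFinite (μ n)] [SigmaFinite M]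
    (hμ : ∀ n A b, μ n (A ×ˢ Set.Iic b) ≠ ∞) (hM : ∀ A b, M (A ×ˢ Set.Iic b) ≠ ∞)
    (hlim : ∀ A, MeasurableSet A → η (frontier A) = 0 → ∀ b,
      Tendsto (fun n => (μ n).real (A ×ˢ Set.Iic b)) atTop (𝓝 (M.real (A ×ˢ Set.Iic b))))
    {G : Set (Fin k → E × ℝ)} (hG : IsOpen G) :
    Measure.pi (fun _ => M) G ≤ liminf (fun n => Measure.pi (fun _ => μ n) G) atTop := by
  set S : Set (Set (Fin k → E × ℝ)) := {s | ∃ (A : Fin k → Set E) (a b : Fin k → ℝ),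
    (∀ j, MeasurableSet (A j)) ∧ (∀ j, η (frontier (A j)) = 0) ∧
      s = Set.univ.pi fun j => A j ×ˢ Set.Ioc (a j) (b j)} with hS
  have hfin : ∀ {ν : Measure (E × ℝ)} [SigmaFinite ν], (∀ A b, ν (A ×ˢ Set.Iic b) ≠ ∞) →
      ∀ s ∈ S, Measure.pi (fun _ => ν) s ≠ ∞ := by
    rintro ν _ hν _ ⟨A, a, b, hA, -, rfl⟩
    rw [Measure.pi_pi]
    refine ENNReal.prod_ne_top fun j _ => ne_top_of_le_ne_top (hν (A j) (b j)) (measure_mono ?_)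
    exact Set.prod_mono_right Set.Ioc_subset_Iic_self
  refine measure_le_liminf_of_isPiSystem (S := S) ?_ ?_ (hfin hM)
    (fun s hs n => hfin (hμ n) s hs) ?_ ?_ hG
  · rintro _ ⟨A, a, b, hA, hA', rfl⟩ _ ⟨B, c, d, hB, hB', rfl⟩ -
    refine ⟨fun j => A j ∩ B j, fun j => max (a j) (c j), fun j => min (b j) (d j),
      fun j => (hA j).inter (hB j), fun j => null_frontier_inter (hA' j) (hB' j), ?_⟩
    rw [← Set.pi_inter_distrib]
    refine Set.pi_congr rfl fun j _ => ?_
    rw [Set.prod_inter_prod, Set.Ioc_inter_Ioc]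
  · rintro _ ⟨A, a, b, hA, -, rfl⟩
    exact MeasurableSet.univ_pi fun j => (hA j).prod measurableSet_Ioc
  · intro u hu x hx
    obtain ⟨ε, εpos, hε⟩ : ∃ ε > 0, Metric.ball x ε ⊆ u := Metric.isOpen_iff.1 hu x hx
    -- Spheres of different radii about a point are disjoint, so arbitrarily small radii give balls
    -- with null frontier.
    have hr : ∀ j, ∃ r ∈ Set.Ioo 0 ε, η (frontier (Metric.thickening r {(x j).1})) = 0 :=
      fun j => exists_null_frontier_thickening _ _ εpos
    choose r hr0 hrη using hr
    refine ⟨_, ⟨fun j => Metric.ball (x j).1 (r j), fun j => (x j).2 - ε / 2,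
      fun j => (x j).2 + ε / 2, fun j => Metric.isOpen_ball.measurableSet,
      fun j => by simpa using hrη j, rfl⟩, ?_, ?_⟩
    · refine set_pi_mem_nhds Set.finite_univ fun j _ => prod_mem_nhds ?_ ?_
      · exact Metric.ball_mem_nhds _ (hr0 j).1
      · exact Ioc_mem_nhds (by linarith) (by linarith)
    · refine Set.Subset.trans (fun z hz => ?_) hε
      rw [Metric.mem_ball, dist_pi_lt_iff εpos]
      intro j
      obtain ⟨h1, h2, h3⟩ := hz j (Set.mem_univ j)
      rw [Prod.dist_eq, max_lt_iff]
      refine ⟨(Metric.mem_ball.1 h1).trans (hr0 j).2, ?_⟩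
      rw [Real.dist_eq, abs_lt]
      constructor <;> linarith
  · rintro _ ⟨A, a, b, hA, hA', rfl⟩
    simp only [measureReal_def, Measure.pi_pi, ENNReal.toReal_prod]
    refine tendsto_finsetProd _ fun j _ => ?_
    simp only [← measureReal_def]
    simp only [measureReal_prod_Ioc (hA j) (hμ _ _), measureReal_prod_Ioc (hA j) (hM _)]
    exact (hlim _ (hA j) (hA' j) _).sub (hlim _ (hA j) (hA' j) _)

/-! ### Weighted empirical averages on continuity sets -/

section Empirical

variable {E : Type*} [TopologicalSpace E] [MeasurableSpace E] [BorelSpace E]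
  [HasOuterApproxClosed E] {x : ℕ → E} {ν : Measure E} [IsFiniteMeasure ν]

/-- The closed-set half of the portmanteau theorem, with a weight: the indicator of `F` is
approximated from above by continuous functions, to which the hypothesis applies after
multiplication by `h`. -/
theorem eventually_average_indicator_lt
    (hx : ∀ φ : E →ᵇ ℝ, Tendsto (fun n : ℕ => (1 / (n : ℝ)) * ∑ i ∈ Finset.range n, φ (x i)) atTop
      (𝓝 (∫ y, φ y ∂ν)))
    {h : E →ᵇ ℝ} (hh : ∀ y, 0 ≤ h y) {F : Set E} (hF : IsClosed F) {r : ℝ}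
    (hr : ∫ y in F, h y ∂ν < r) :
    ∀ᶠ n : ℕ in atTop, (1 / (n : ℝ)) * ∑ i ∈ Finset.range n, F.indicator h (x i) < r := by
  set φ : ℕ → E →ᵇ ℝ := fun m =>
    (BoundedContinuousFunction.ofNormedAddCommGroup (fun y => (hF.apprSeq m y : ℝ))
      (by fun_prop) 1 (fun y => by
        simpa using HasOuterApproxClosed.apprSeq_apply_le_one hF m y)) * h with hφ
  have hφval : ∀ m y, φ m y = (hF.apprSeq m y : ℝ) * h y := fun m y => rfl
  have hlim : Tendsto (fun m => ∫ y, φ m y ∂ν) atTop (𝓝 (∫ y in F, h y ∂ν)) := by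
    rw [← integral_indicator hF.measurableSet]
    refine tendsto_integral_of_dominated_convergence (fun _ => ‖h‖)
      (fun m => (φ m).continuous.aestronglyMeasurable) (integrable_const _) (fun m => ?_) ?_
    · refine Eventually.of_forall fun y => ?_
      rw [hφval, norm_mul]
      have h1 : ‖(hF.apprSeq m y : ℝ)‖ ≤ 1 := by simpa using HasOuterApproxClosed.apprSeq_apply_le_one hF m y
      calc _ ≤ 1 * ‖h‖ := mul_le_mul h1 (h.norm_coe_le_norm y) (norm_nonneg _) zero_le_one
        _ = ‖h‖ := one_mul _
    · refine Eventually.of_forall fun y => ?_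
      have h1 := (tendsto_pi_nhds.1 (HasOuterApproxClosed.tendsto_apprSeq hF)) y
      have h2 : Tendsto (fun m => (hF.apprSeq m y : ℝ) * h y) atTop
          (𝓝 (((F.indicator (fun _ => (1 : NNReal)) y : NNReal) : ℝ) * h y)) :=
        ((NNReal.tendsto_coe.2 h1)).mul_const _
      refine h2.congr' (Eventually.of_forall fun m => (hφval m y).symm) |>.trans ?_
      by_cases hy : y ∈ F <;> simp [hy]
  obtain ⟨m, hm⟩ := ((tendsto_order.1 hlim).2 r hr).exists
  filter_upwards [(tendsto_order.1 (hx (φ m))).2 r hm] with n hn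
  refine lt_of_le_of_lt ?_ hn
  refine mul_le_mul_of_nonneg_left (Finset.sum_le_sum fun i _ => ?_) (by positivity)
  rw [hφval]
  by_cases hy : x i ∈ F
  · rw [Set.indicator_of_mem hy, HasOuterApproxClosed.apprSeq_apply_eq_one hF m hy]; simp
  · rw [Set.indicator_of_notMem hy]
    exact mul_nonneg (by positivity) (hh _)

/-- The upper bound on the closure is applied to `A` and to its complement; subtracting the latter
from the convergent total gives the lower bound for `A`. -/
theorem tendsto_average_indicator
    (hx : ∀ φ : E →ᵇ ℝ, Tendsto (fun n : ℕ => (1 / (n : ℝ)) * ∑ i ∈ Finset.range n, φ (x i)) atTop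
      (𝓝 (∫ y, φ y ∂ν)))
    {h : E →ᵇ ℝ} (hh : ∀ y, 0 ≤ h y) {A : Set E} (hA : MeasurableSet A)
    (hA' : ν (frontier A) = 0) :
    Tendsto (fun n : ℕ => (1 / (n : ℝ)) * ∑ i ∈ Finset.range n, A.indicator h (x i)) atTop
      (𝓝 (∫ y in A, h y ∂ν)) := by
  have hint : Integrable h ν := h.integrable ν
  have hcl : ∀ B : Set E, ν (frontier B) = 0 →
      ∫ y in closure B, h y ∂ν = ∫ y in B, h y ∂ν := fun B hB =>
    setIntegral_congr_set (closure_ae_eq_of_null_frontier hB)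
  have hup : ∀ B : Set E, ν (frontier B) = 0 → ∀ r > ∫ y in B, h y ∂ν,
      ∀ᶠ n : ℕ in atTop, (1 / (n : ℝ)) * ∑ i ∈ Finset.range n, B.indicator h (x i) < r := by
    intro B hB r hr
    rw [gt_iff_lt, ← hcl B hB] at hr
    filter_upwards [eventually_average_indicator_lt hx hh isClosed_closure hr] with n hn
    refine lt_of_le_of_lt ?_ hn
    refine mul_le_mul_of_nonneg_left (Finset.sum_le_sum fun i _ => ?_) (by positivity)
    exact Set.indicator_le_indicator_of_subset subset_closure hh _
  refine tendsto_order.2 ⟨fun r hr => ?_, fun r hr => hup A hA' r hr⟩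
  have hsplit := integral_add_compl hA hint
  set ε := (∫ y in A, h y ∂ν - r) / 2 with hε
  have hεpos : 0 < ε := by linarith
  filter_upwards [hup Aᶜ (by rwa [frontier_compl]) (∫ y in Aᶜ, h y ∂ν + ε) (by linarith),
    (tendsto_order.1 (hx h)).1 (∫ y, h y ∂ν - ε) (by linarith)] with n h1 h2
  have h3 : (1 / (n : ℝ)) * ∑ i ∈ Finset.range n, A.indicator h (x i) +
      (1 / (n : ℝ)) * ∑ i ∈ Finset.range n, Aᶜ.indicator h (x i) =
      (1 / (n : ℝ)) * ∑ i ∈ Finset.range n, h (x i) := by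
    rw [← mul_add, ← Finset.sum_add_distrib]
    congr 1
    exact Finset.sum_congr rfl fun i _ => Set.indicator_self_add_compl_apply A h (x i)
  linarith

end Empirical

/-! ### The cumulative rate -/

section CumRate

variable {E : Type*} [MeasurableSpace E] {ν : Measure E} [IsFiniteMeasure ν] {g : E → ℝ} {B : ℝ}

/-- `∫ (t - g)^+ dν`. -/
noncomputable def cumRate (ν : Measure E) (g : E → ℝ) (t : ℝ) : ℝ := ∫ y, max (t - g y) 0 ∂ν

theorem integrable_max_sub (hg : Measurable g) (hB : ∀ y, |g y| ≤ B) (t : ℝ) :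
    Integrable (fun y => max (t - g y) 0) ν := by
  refine Integrable.of_bound (C := |t| + B) (by fun_prop) (Eventually.of_forall fun y => ?_)
  rw [Real.norm_of_nonneg (le_max_right _ _)]
  have := abs_le.1 (hB y)
  exact max_le (by linarith [le_abs_self t]) (by linarith [abs_nonneg t, (abs_nonneg _).trans (hB y)])

theorem cumRate_mono (hg : Measurable g) (hB : ∀ y, |g y| ≤ B) : Monotone (cumRate ν g) :=
  fun s t hst => integral_mono (integrable_max_sub hg hB s) (integrable_max_sub hg hB t)
    fun y => max_le_max_right 0 (by linarith)

theorem cumRate_eq_zero {E : Type*} [MeasurableSpace E] {ν : Measure E} {g : E → ℝ} {B : ℝ}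
    (hB : ∀ y, |g y| ≤ B) {t : ℝ} (ht : t ≤ -B) : cumRate ν g t = 0 := by
  have : ∀ y, max (t - g y) 0 = 0 := fun y => max_eq_right (by linarith [(abs_le.1 (hB y)).1])
  simp [cumRate, this]

theorem le_cumRate (hg : Measurable g) (hB : ∀ y, |g y| ≤ B) (t : ℝ) :
    ν.real Set.univ * (t - B) ≤ cumRate ν g t := by
  have h : ∫ _ : E, (t - B) ∂ν = ν.real Set.univ * (t - B) := by simp
  rw [← h]
  exact integral_mono (integrable_const _) (integrable_max_sub hg hB t)
    fun y => (by linarith [(abs_le.1 (hB y)).2] : t - B ≤ t - g y).trans (le_max_left _ _)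

theorem cumRate_sub_le (hg : Measurable g) (hB : ∀ y, |g y| ≤ B) {s t : ℝ} (hst : s ≤ t) :
    cumRate ν g t - cumRate ν g s ≤ ν.real Set.univ * (t - s) := by
  have h : ∫ _ : E, (t - s) ∂ν = ν.real Set.univ * (t - s) := by simp
  rw [← h, cumRate, cumRate,
    ← integral_sub (integrable_max_sub hg hB t) (integrable_max_sub hg hB s)]
  refine integral_mono ((integrable_max_sub hg hB t).sub (integrable_max_sub hg hB s))
    (integrable_const _) fun y => ?_
  change max (t - g y) 0 - max (s - g y) 0 ≤ t - s
  grind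

theorem continuous_cumRate (hg : Measurable g) (hB : ∀ y, |g y| ≤ B) :
    Continuous (cumRate ν g) := by
  refine (LipschitzWith.of_dist_le_mul (K := (ν.real Set.univ).toNNReal) fun s t => ?_).continuous
  rw [Real.coe_toNNReal _ measureReal_nonneg, Real.dist_eq, Real.dist_eq]
  rcases le_total s t with h | h
  · rw [abs_sub_comm, abs_sub_comm s, abs_of_nonneg (sub_nonneg.2 (cumRate_mono hg hB h)),
      abs_of_nonneg (sub_nonneg.2 h)]
    exact cumRate_sub_le hg hB h
  · rw [abs_of_nonneg (sub_nonneg.2 (cumRate_mono hg hB h)), abs_of_nonneg (sub_nonneg.2 h)]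
    exact cumRate_sub_le hg hB h

theorem measurableSet_le_le (hg : Measurable g) (t : ℝ) :
    MeasurableSet {z : E × ℝ | g z.1 ≤ z.2 ∧ z.2 ≤ t} :=
  (measurableSet_le (hg.comp measurable_fst) measurable_snd).inter
    (measurableSet_le measurable_snd measurable_const)

/-- The cumulative rate is the integral of the distribution function of `g`. -/
theorem integral_Iic_measureReal_le (hg : Measurable g) (hB : ∀ y, -B ≤ g y) (t : ℝ) :
    IntegrableOn (fun s => ν.real {y | g y ≤ s}) (Set.Iic t) ∧
      ∫ s in Set.Iic t, ν.real {y | g y ≤ s} = cumRate ν g t := by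
  have hmono : Monotone fun s => ν.real {y | g y ≤ s} := fun s s' h =>
    measureReal_mono fun y (hy : g y ≤ s) => hy.trans h
  -- Tonelli on the region `g y ≤ s ≤ t`, sliced in both directions.
  have hl : ∫⁻ s in Set.Iic t, ENNReal.ofReal (ν.real {y | g y ≤ s}) =
      ∫⁻ y, ENNReal.ofReal (max (t - g y) 0) ∂ν := by
    have h1 := Measure.prod_apply (μ := ν) (ν := volume) (measurableSet_le_le hg t)
    have h2 := Measure.prod_apply_symm (μ := ν) (ν := (volume : Measure ℝ))
      (measurableSet_le_le hg t)
    rw [h1] at h2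
    rw [← lintegral_indicator measurableSet_Iic]
    convert h2.symm using 2
    · funext s
      by_cases hs : s ≤ t
      · simp [hs]
      · simp [hs]
    · funext y
      have : Prod.mk y ⁻¹' {z : E × ℝ | g z.1 ≤ z.2 ∧ z.2 ≤ t} = Set.Icc (g y) t := rfl
      rw [this, Real.volume_Icc, ENNReal.ofReal_max]
      simp
  have hfin : ∫⁻ y, ENNReal.ofReal (max (t - g y) 0) ∂ν < ∞ := by
    refine lt_of_le_of_lt (lintegral_mono (g := fun _ => ENNReal.ofReal (max (t + B) 0))
      fun y => ENNReal.ofReal_le_ofReal (max_le_max_right 0 (by linarith [hB y]))) ?_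
    rw [lintegral_const]
    exact ENNReal.mul_lt_top ENNReal.ofReal_lt_top (measure_lt_top _ _)
  refine ⟨⟨hmono.measurable.aestronglyMeasurable, ?_⟩, ?_⟩
  · rw [hasFiniteIntegral_iff_ofReal (Eventually.of_forall fun s => measureReal_nonneg), hl]
    exact hfin
  · rw [integral_eq_lintegral_of_nonneg_ae (Eventually.of_forall fun s => measureReal_nonneg)
      hmono.measurable.aestronglyMeasurable, hl, cumRate,
      integral_eq_lintegral_of_nonneg_ae (f := fun y => max (t - g y) 0)
      (Eventually.of_forall fun y => le_max_right _ _)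
      (by fun_prop : Measurable fun y => max (t - g y) 0).aestronglyMeasurable]

/-- Only a right derivative is available: the distribution function of `g` is right continuous and
jumps where a level set of `g` has positive mass. -/
theorem hasDerivWithinAt_cumRate (hg : Measurable g) (hB : ∀ y, |g y| ≤ B) (t : ℝ) :
    HasDerivWithinAt (cumRate ν g) (ν.real {y | g y ≤ t}) (Set.Ioi t) t := by
  have hmono : Monotone fun s => ν.real {y | g y ≤ s} := fun s s' h =>
    measureReal_mono fun y (hy : g y ≤ s) => hy.trans h
  have hI := integral_Iic_measureReal_le (ν := ν) hg fun y => (abs_le.1 (hB y)).1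
  have hcont : ContinuousWithinAt (fun s => ν.real {y | g y ≤ s}) (Set.Ioi t) t := by
    have hrw : (fun s => ν.real {y | g y ≤ s}) =
        fun s => ∫ y, {y | g y ≤ s}.indicator (fun _ => (1 : ℝ)) y ∂ν := by
      funext s
      rw [integral_indicator (measurableSet_le hg measurable_const)]
      simp
    rw [hrw]
    refine continuousWithinAt_of_dominated (bound := fun _ => 1)
      (Eventually.of_forall fun s => ?_) (Eventually.of_forall fun s => ?_)
      (integrable_const _) (Eventually.of_forall fun y => ?_)
    · exact (measurable_const.indicator
        (measurableSet_le hg measurable_const)).aestronglyMeasurable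
    · refine Eventually.of_forall fun y => ?_
      by_cases h : y ∈ {y | g y ≤ s} <;> simp [h]
    · rcases le_or_gt (g y) t with h | h
      · refine (continuousWithinAt_const (b := (1 : ℝ))).congr (fun s hs => ?_) ?_
        · simp [h.trans (le_of_lt hs)]
        · simp [h]
      · refine ((continuousAt_const (y := (0 : ℝ))).congr ?_).continuousWithinAt
        filter_upwards [eventually_lt_nhds h] with s hs
        simp [hs]
  have hint : ∀ u, IntervalIntegrable (fun s => ν.real {y | g y ≤ s}) volume t u := fun u =>
    hmono.intervalIntegrable
  have h := intervalIntegral.integral_hasDerivWithinAt_right (s := Set.Ici t) (t := Set.Ioi t)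
    (a := t) (hint t)
    hmono.measurable.aestronglyMeasurable.stronglyMeasurableAtFilter hcont
  refine ((h.mono Set.Ioi_subset_Ici_self).const_add (cumRate ν g t)).congr (fun u _ => ?_)
    (by simp)
  rw [← intervalIntegral.integral_Iic_sub_Iic (hI t).1 (hI u).1, (hI u).2, (hI t).2]
  ring

end CumRate

/-! ### The limiting intensity measure and the total mass -/

section HeightMeasure

variable {E : Type*} [MeasurableSpace E] {ν : Measure E} [IsFiniteMeasure ν] {g : E → ℝ} {B : ℝ}

/-- The measure `ν(dy) dt` on the region `{t > g(y)}`. -/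
noncomputable def heightMeasure (ν : Measure E) (g : E → ℝ) : Measure (E × ℝ) :=
  (ν.prod volume).restrict {z | g z.1 < z.2}

instance : SigmaFinite (heightMeasure ν g) := by
  unfold heightMeasure; infer_instance

theorem measurableSet_height_lt (hg : Measurable g) : MeasurableSet {z : E × ℝ | g z.1 < z.2} :=
  measurableSet_lt (hg.comp measurable_fst) measurable_snd

theorem tendsto_exp_neg_cumRate (hg : Measurable g) (hB : ∀ y, |g y| ≤ B)
    (hν : 0 < ν.real Set.univ) :
    Tendsto (fun t => Real.exp (-cumRate ν g t)) atTop (𝓝 0) := by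
  refine Real.tendsto_exp_neg_atTop_nhds_zero.comp ?_
  refine tendsto_atTop_mono (le_cumRate hg hB) ?_
  exact (tendsto_atTop_add_const_right _ _ tendsto_id).const_mul_atTop hν

/-- The integrand is minus the right derivative of `exp (-Λ)`, so the fundamental theorem of
calculus applies; the boundary term at infinity vanishes because Λ grows at least linearly. -/
theorem integral_Ioi_mul_exp_neg_cumRate (hg : Measurable g) (hB : ∀ y, |g y| ≤ B)
    (hν : 0 < ν.real Set.univ) (r : ℝ) :
    IntegrableOn (fun s => ν.real {y | g y ≤ s} * Real.exp (-cumRate ν g s)) (Set.Ioi r) ∧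
    ∫ s in Set.Ioi r, ν.real {y | g y ≤ s} * Real.exp (-cumRate ν g s) =
      Real.exp (-cumRate ν g r) := by
  have hmono : Monotone fun s => ν.real {y | g y ≤ s} := fun s s' h =>
    measureReal_mono fun y (hy : g y ≤ s) => hy.trans h
  have hcont : Continuous fun s => Real.exp (-cumRate ν g s) :=
    Real.continuous_exp.comp (continuous_cumRate hg hB).neg
  have hii : ∀ a b, IntervalIntegrable
      (fun s => ν.real {y | g y ≤ s} * Real.exp (-cumRate ν g s)) volume a b := fun a b =>
    hmono.intervalIntegrable.mul_continuousOn hcont.continuousOn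
  have hftc : ∀ b, ∫ s in r..b, ν.real {y | g y ≤ s} * Real.exp (-cumRate ν g s) =
      Real.exp (-cumRate ν g r) - Real.exp (-cumRate ν g b) := by
    intro b
    rw [intervalIntegral.integral_eq_sub_of_hasDeriv_right
      (f := fun s => -Real.exp (-cumRate ν g s)) hcont.neg.continuousOn (fun s _ => ?_) (hii r b)]
    · ring
    · refine ((hasDerivWithinAt_cumRate (ν := ν) hg hB s).neg.exp).neg.congr_deriv ?_
      simp only [Pi.neg_apply]
      ring
  have hlim : Tendsto (fun b => ∫ s in r..b, ν.real {y | g y ≤ s} * Real.exp (-cumRate ν g s))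
      atTop (𝓝 (Real.exp (-cumRate ν g r))) := by
    simp only [hftc]
    simpa using (tendsto_exp_neg_cumRate hg hB hν).const_sub (Real.exp (-cumRate ν g r))
  have hint : IntegrableOn (fun s => ν.real {y | g y ≤ s} * Real.exp (-cumRate ν g s))
      (Set.Ioi r) := by
    refine integrableOn_Ioi_of_intervalIntegral_norm_tendsto (b := id) (l := atTop)
      (Real.exp (-cumRate ν g r)) r (fun b => (hii r b).1) tendsto_id ?_
    refine hlim.congr fun b => intervalIntegral.integral_congr fun s _ => ?_
    exact (Real.norm_of_nonneg (mul_nonneg measureReal_nonneg (Real.exp_pos _).le)).symm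
  exact ⟨hint, tendsto_nhds_unique (intervalIntegral_tendsto_integral_Ioi r hint tendsto_id) hlim⟩

/-- The graph of `g` is null. This reconciles the strict inequality in `heightMeasure` with the weak
one in the distribution function of `g`. -/
theorem height_lt_ae_eq_le {E : Type*} [MeasurableSpace E] {ν : Measure E} {g : E → ℝ}
    (hg : Measurable g) :
    ({z : E × ℝ | g z.1 < z.2} : Set (E × ℝ)) =ᵐ[ν.prod volume] {z | g z.1 ≤ z.2} := by
  have h0 : (ν.prod volume) {z : E × ℝ | g z.1 = z.2} = 0 := by
    have hm : MeasurableSet {z : E × ℝ | g z.1 = z.2} :=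
      measurableSet_eq_fun (hg.comp measurable_fst) measurable_snd
    rw [Measure.measure_prod_null hm]
    refine Eventually.of_forall fun y => ?_
    have : Prod.mk y ⁻¹' {z : E × ℝ | g z.1 = z.2} = {g y} := by
      ext t; simp [eq_comm]
    simp [this]
  have h : ∀ᵐ z ∂(ν.prod volume), g z.1 ≠ z.2 := by
    rw [ae_iff]; simpa using h0
  filter_upwards [h] with z hz
  exact propext ⟨fun h : g z.1 < z.2 => h.le, fun h : g z.1 ≤ z.2 => lt_of_le_of_ne h hz⟩

theorem heightMeasure_eq_le {E : Type*} [MeasurableSpace E] {ν : Measure E} {g : E → ℝ}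
    (hg : Measurable g) :
    heightMeasure ν g = (ν.prod volume).restrict {z | g z.1 ≤ z.2} :=
  Measure.restrict_congr_set (height_lt_ae_eq_le hg)

/-- At height `s` the positions contribute the mass of `{g ≤ s}`, which is the right derivative of
Λ. This is the step by which the highest point is integrated out. -/
theorem lintegral_heightMeasure_Ioi (hg : Measurable g) (hB : ∀ y, |g y| ≤ B)
    (hν : 0 < ν.real Set.univ) (r : ℝ) :
    ∫⁻ z in {z : E × ℝ | r < z.2}, ENNReal.ofReal (Real.exp (-cumRate ν g z.2))
      ∂(heightMeasure ν g) = ENNReal.ofReal (Real.exp (-cumRate ν g r)) := by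
  have hcont : Continuous fun s => ENNReal.ofReal (Real.exp (-cumRate ν g s)) :=
    ENNReal.continuous_ofReal.comp (Real.continuous_exp.comp (continuous_cumRate hg hB).neg)
  have hm1 : MeasurableSet {z : E × ℝ | r < z.2} := measurableSet_lt measurable_const measurable_snd
  have hm2 : MeasurableSet {z : E × ℝ | g z.1 ≤ z.2} :=
    measurableSet_le (hg.comp measurable_fst) measurable_snd
  obtain ⟨hi, he⟩ := integral_Ioi_mul_exp_neg_cumRate hg hB hν r
  rw [← he, ofReal_integral_eq_lintegral_ofReal hi
    (Eventually.of_forall fun s => mul_nonneg measureReal_nonneg (Real.exp_pos _).le),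
    heightMeasure_eq_le hg, Measure.restrict_restrict hm1,
    ← lintegral_indicator (hm1.inter hm2), ← lintegral_indicator measurableSet_Ioi,
    lintegral_prod_symm]
  · refine lintegral_congr fun s => ?_
    by_cases hs : r < s
    · rw [Set.indicator_of_mem (show s ∈ Set.Ioi r from hs),
        ENNReal.ofReal_mul measureReal_nonneg, ofReal_measureReal, mul_comm]
      change _ = _ * ν (g ⁻¹' Set.Iic s)
      rw [← lintegral_indicator_const (hg measurableSet_Iic)]
      refine lintegral_congr fun y => ?_
      simp only [Set.indicator, Set.mem_inter_iff, Set.mem_ofPred_eq, hs, true_and,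
        Set.mem_preimage, Set.mem_Iic]
    · rw [Set.indicator_of_notMem (show s ∉ Set.Ioi r from hs)]
      simp [hs]
  · exact ((hcont.measurable.comp measurable_snd).indicator (hm1.inter hm2)).aemeasurable

end HeightMeasure

theorem isOpen_setOf_strictMono {k : ℕ} : IsOpen {t : Fin k → ℝ | StrictMono t} := by
  have : {t : Fin k → ℝ | StrictMono t} = ⋂ i, ⋂ j, ⋂ (_ : i < j), {t | t i < t j} := by
    ext t
    simp only [Set.mem_ofPred_eq, Set.mem_iInter]
    exact ⟨fun h i j hij => h hij, fun h i j hij => h i j hij⟩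
  rw [this]
  exact isOpen_iInter_of_finite fun i => isOpen_iInter_of_finite fun j =>
    isOpen_iInter_of_finite fun _ => isOpen_lt (continuous_apply i) (continuous_apply j)

theorem strictMono_fin_succ_iff {m : ℕ} {t : Fin (m + 2) → ℝ} :
    StrictMono t ↔ StrictMono (fun j : Fin (m + 1) => t j.castSucc) ∧
      t (Fin.last m).castSucc < t (Fin.last (m + 1)) := by
  rw [Fin.strictMono_iff_lt_succ, Fin.strictMono_iff_lt_succ, Fin.forall_fin_succ']
  rfl

section TotalMass

variable {E : Type*} [MeasurableSpace E] {ν : Measure E} [IsFiniteMeasure ν] {g : E → ℝ} {B : ℝ}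

theorem lintegral_pi_heightMeasure_eq_one (hg : Measurable g) (hB : ∀ y, |g y| ≤ B)
    (hν : 0 < ν.real Set.univ) (m : ℕ) :
    ∫⁻ z in {z : Fin (m + 1) → E × ℝ | StrictMono fun j => (z j).2},
      ENNReal.ofReal (Real.exp (-cumRate ν g (z (Fin.last m)).2))
      ∂(Measure.pi fun _ => heightMeasure ν g) = 1 := by
  have hcont : Continuous fun s => ENNReal.ofReal (Real.exp (-cumRate ν g s)) :=
    ENNReal.continuous_ofReal.comp (Real.continuous_exp.comp (continuous_cumRate hg hB).neg)
  have hW : ∀ m : ℕ, MeasurableSet {z : Fin (m + 1) → E × ℝ | StrictMono fun j => (z j).2} :=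
    fun m => isOpen_setOf_strictMono.measurableSet.preimage
      (f := fun (z : Fin (m + 1) → E × ℝ) j => (z j).2) (by fun_prop)
  induction m with
  | zero =>
    have hall : {z : Fin (0 + 1) → E × ℝ | StrictMono fun j => (z j).2} = Set.univ :=
      Set.eq_univ_of_forall fun z a b hab =>
        absurd (Subsingleton.elim (α := Fin 1) a b) hab.ne
    rw [hall, Measure.restrict_univ]
    have h1 := (measurePreserving_funUnique (heightMeasure ν g) (Fin 1)).lintegral_comp
      (f := fun w : E × ℝ => ENNReal.ofReal (Real.exp (-cumRate ν g w.2)))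
      (hcont.measurable.comp measurable_snd)
    refine Eq.trans h1 ?_
    -- The level `-B - 1` lies below every value of `g`: the restriction to greater heights is no
    -- restriction, and the cumulative rate there is zero.
    have h2 := lintegral_heightMeasure_Ioi hg hB hν (-B - 1)
    rw [cumRate_eq_zero hB (by linarith)] at h2
    simp only [neg_zero, Real.exp_zero, ENNReal.ofReal_one] at h2
    rw [← h2]
    refine (setLIntegral_univ _).symm.trans ?_
    rw [heightMeasure, Measure.restrict_restrict MeasurableSet.univ, Measure.restrict_restrict
      (measurableSet_lt measurable_const measurable_snd)]
    congr 2
    ext z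
    simp only [Set.mem_inter_iff, Set.mem_univ, true_and, Set.mem_ofPred_eq]
    have := (abs_le.1 (hB z.1)).1
    grind
  | succ m ih =>
    set M := heightMeasure ν g with hM
    set F : (E × ℝ) × (Fin (m + 1) → E × ℝ) → ℝ≥0∞ := fun p =>
      {p : (E × ℝ) × (Fin (m + 1) → E × ℝ) | (StrictMono fun j => (p.2 j).2) ∧
        (p.2 (Fin.last m)).2 < p.1.2}.indicator
      (fun p => ENNReal.ofReal (Real.exp (-cumRate ν g p.1.2))) p with hF
    have hFm : Measurable F := by
      refine (hcont.measurable.comp (measurable_snd.comp measurable_fst)).indicator ?_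
      have hlt : MeasurableSet {p : (E × ℝ) × (Fin (m + 1) → E × ℝ) |
          (p.2 (Fin.last m)).2 < p.1.2} :=
        measurableSet_lt (measurable_snd.comp ((measurable_pi_apply _).comp measurable_snd))
          (measurable_snd.comp measurable_fst)
      exact ((hW m).preimage measurable_snd).inter hlt
    have h1 := (measurePreserving_piFinSuccAbove (fun _ : Fin (m + 2) => M)
      (Fin.last (m + 1))).lintegral_comp hFm
    rw [← lintegral_indicator (hW (m + 1))]
    refine Eq.trans (lintegral_congr fun z => ?_) (h1.trans ?_)
    · have heq : MeasurableEquiv.piFinSuccAbove (fun _ : Fin (m + 2) => E × ℝ) (Fin.last (m + 1)) z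
          = (z (Fin.last (m + 1)), fun j => z j.castSucc) := by
        ext <;> simp [MeasurableEquiv.piFinSuccAbove, Fin.init]
      rw [heq]
      simp only [hF, Set.indicator, Set.mem_ofPred_eq]
      exact if_congr strictMono_fin_succ_iff rfl rfl
    · rw [lintegral_prod_symm _ hFm.aemeasurable, ← ih, ← lintegral_indicator (hW m)]
      refine lintegral_congr fun z => ?_
      by_cases hz : StrictMono fun j => (z j).2
      · rw [Set.indicator_of_mem (show z ∈ {z : Fin (m + 1) → E × ℝ | StrictMono fun j => (z j).2}
          from hz), ← lintegral_heightMeasure_Ioi hg hB hν, ← lintegral_indicator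
          (measurableSet_lt measurable_const measurable_snd)]
        refine lintegral_congr fun w => ?_
        simp only [hF, Set.indicator, Set.mem_ofPred_eq, hz, true_and]
      · rw [Set.indicator_of_notMem (show z ∉ {z : Fin (m + 1) → E × ℝ |
          StrictMono fun j => (z j).2} from hz)]
        simp [hF, hz]

end TotalMass

theorem indicator_eq_indicator_of_iff {α β γ : Type*} [Zero γ] {s : Set α} {t : Set β}
    {f : α → γ} {g : β → γ} {a : α} {b : β} (h : a ∈ s ↔ b ∈ t) (hfg : f a = g b) :
    s.indicator f a = t.indicator g b := by
  by_cases ha : a ∈ s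
  · rw [Set.indicator_of_mem ha, Set.indicator_of_mem (h.1 ha), hfg]
  · rw [Set.indicator_of_notMem ha, Set.indicator_of_notMem (mt h.2 ha)]

/-! ### Products of measures with densities -/

theorem lintegral_pi_prod_eq_prod_lintegral {E : Type*} [MeasurableSpace E] {μ : Measure E}
    [SigmaFinite μ] {k : ℕ} {f : Fin k → E → ℝ≥0∞} (hf : ∀ j, Measurable (f j)) :
    ∫⁻ x, ∏ j, f j (x j) ∂(Measure.pi fun _ : Fin k => μ) = ∏ j, ∫⁻ y, f j y ∂μ := by
  induction k with
  | zero => simp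
  | succ k ih =>
    have hm : Measurable fun p : Fin k → E => ∏ j : Fin k, f j.succ (p j) :=
      Finset.measurable_fun_prod _ fun j _ => (hf j.succ).comp (measurable_pi_apply j)
    have h1 := (measurePreserving_piFinSuccAbove (fun _ : Fin (k + 1) => μ) 0).lintegral_comp
      (f := fun p : E × (Fin k → E) => f 0 p.1 * ∏ j : Fin k, f j.succ (p.2 j))
      (((hf 0).comp measurable_fst).mul (hm.comp measurable_snd))
    rw [Fin.prod_univ_succ, ← ih fun j => hf j.succ]
    refine Eq.trans (lintegral_congr fun x => ?_)
      (h1.trans (lintegral_prod_mul (hf 0).aemeasurable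
        hm.aemeasurable))
    rw [Fin.prod_univ_succ]
    rfl

theorem pi_withDensity {E : Type*} [MeasurableSpace E] {μ : Measure E} [SigmaFinite μ] {k : ℕ}
    {f : E → ℝ≥0∞} (hf : AEMeasurable f μ) [SigmaFinite (μ.withDensity f)] :
    Measure.pi (fun _ : Fin k => μ.withDensity f) =
      (Measure.pi fun _ : Fin k => μ).withDensity fun x => ∏ j, f (x j) := by
  -- Since `f` is only almost everywhere measurable, it is replaced by a measurable representative
  -- in every coordinate.
  have hae : (fun x : Fin k → E => ∏ j, f (x j)) =ᵐ[Measure.pi fun _ => μ]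
      fun x => ∏ j, hf.mk f (x j) := by
    have : ∀ᵐ x ∂(Measure.pi fun _ : Fin k => μ), ∀ j, f (x j) = hf.mk f (x j) :=
      ae_all_iff.2 fun j => (Measure.quasiMeasurePreserving_eval (fun _ => μ) j).ae hf.ae_eq_mk
    filter_upwards [this] with x hx
    exact Finset.prod_congr rfl fun j _ => hx j
  rw [withDensity_congr_ae hae]
  refine Measure.pi_eq fun s hs => ?_
  rw [withDensity_apply _ (MeasurableSet.univ_pi hs), ← lintegral_indicator
    (MeasurableSet.univ_pi hs)]
  have h1 : ∀ x : Fin k → E, (Set.univ.pi s).indicator (fun x => ∏ j, hf.mk f (x j)) x =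
      ∏ j, (s j).indicator (hf.mk f) (x j) := by
    intro x
    by_cases hx : x ∈ Set.univ.pi s
    · rw [Set.indicator_of_mem hx]
      exact Finset.prod_congr rfl fun j _ => (Set.indicator_of_mem (hx j (Set.mem_univ j)) _).symm
    · rw [Set.indicator_of_notMem hx]
      simp only [Set.mem_univ_pi, not_forall] at hx
      obtain ⟨j, hj⟩ := hx
      exact (Finset.prod_eq_zero (Finset.mem_univ j) (Set.indicator_of_notMem hj _)).symm
  simp only [h1]
  rw [lintegral_pi_prod_eq_prod_lintegral fun j => hf.measurable_mk.indicator (hs j)]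
  refine Finset.prod_congr rfl fun j _ => ?_
  rw [lintegral_indicator (hs j), withDensity_apply _ (hs j)]
  exact lintegral_congr_ae (ae_restrict_of_ae hf.ae_eq_mk.symm)

/-! ### The integrals over heights -/

section LimitKernel

variable {E : Type*} [MeasurableSpace E] {ν : Measure E} [IsFiniteMeasure ν] {g : E → ℝ} {B : ℝ}

/-- The conditional weight of heights above the points `x 0, …, x m`. -/
noncomputable def heightKernel (ν : Measure E) (g : E → ℝ) {m : ℕ} (x : Fin (m + 1) → E) : ℝ≥0∞ :=
  ∫⁻ r in {r : Fin (m + 1) → ℝ | StrictMono r ∧ ∀ j, g (x j) < r j},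
    ENNReal.ofReal (Real.exp (-cumRate ν g (r (Fin.last m))))

theorem measurable_ofReal_exp_neg_cumRate (hg : Measurable g) (hB : ∀ y, |g y| ≤ B) :
    Measurable fun t => ENNReal.ofReal (Real.exp (-cumRate ν g t)) :=
  (ENNReal.continuous_ofReal.comp
    (Real.continuous_exp.comp (continuous_cumRate hg hB).neg)).measurable

theorem measurableSet_strictMono_and_lt (hg : Measurable g) (m : ℕ) :
    MeasurableSet {p : (Fin (m + 1) → E) × (Fin (m + 1) → ℝ) |
      StrictMono p.2 ∧ ∀ j, g (p.1 j) < p.2 j} := by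
  refine (isOpen_setOf_strictMono.measurableSet.preimage measurable_snd).inter ?_
  change MeasurableSet {p : (Fin (m + 1) → E) × (Fin (m + 1) → ℝ) | ∀ j, g (p.1 j) < p.2 j}
  simp only [Set.ofPred_forall]
  exact MeasurableSet.iInter fun j => measurableSet_lt
    (hg.comp ((measurable_pi_apply j).comp measurable_fst))
    ((measurable_pi_apply j).comp measurable_snd)

theorem measurableSet_strictMono_and_lt_section (hg : Measurable g) {m : ℕ}
    (x : Fin (m + 1) → E) :
    MeasurableSet {r : Fin (m + 1) → ℝ | StrictMono r ∧ ∀ j, g (x j) < r j} :=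
  (measurableSet_strictMono_and_lt hg m).preimage (measurable_prodMk_left (x := x))

theorem measurable_heightKernel (hg : Measurable g) (hB : ∀ y, |g y| ≤ B) (m : ℕ) :
    Measurable fun x : Fin (m + 1) → E => heightKernel ν g x := by
  have hS := measurable_ofReal_exp_neg_cumRate (ν := ν) hg hB
  have h := Measurable.lintegral_prod_right' (ν := (volume : Measure (Fin (m + 1) → ℝ)))
    (f := {p : (Fin (m + 1) → E) × (Fin (m + 1) → ℝ) |
      StrictMono p.2 ∧ ∀ j, g (p.1 j) < p.2 j}.indicator fun p =>
        ENNReal.ofReal (Real.exp (-cumRate ν g (p.2 (Fin.last m)))))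
    ((hS.comp ((measurable_pi_apply _).comp measurable_snd)).indicator
      (measurableSet_strictMono_and_lt hg m))
  convert h using 1
  funext x
  rw [heightKernel, ← lintegral_indicator (measurableSet_strictMono_and_lt_section hg x)]
  rfl

/-- Integrating over the heights first. -/
theorem setLIntegral_pi_heightMeasure (hg : Measurable g) (hB : ∀ y, |g y| ≤ B) {m : ℕ}
    {U : Set (Fin (m + 1) → E)} (hU : MeasurableSet U) :
    ∫⁻ z in {z : Fin (m + 1) → E × ℝ | (fun j => (z j).1) ∈ U ∧ StrictMono fun j => (z j).2},
      ENNReal.ofReal (Real.exp (-cumRate ν g (z (Fin.last m)).2))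
      ∂(Measure.pi fun _ => heightMeasure ν g) =
    ∫⁻ x in U, heightKernel ν g x ∂(Measure.pi fun _ => ν) := by
  have hS := measurable_ofReal_exp_neg_cumRate (ν := ν) hg hB
  set A : Set ((Fin (m + 1) → E) × (Fin (m + 1) → ℝ)) :=
    {p | p.1 ∈ U ∧ StrictMono p.2 ∧ ∀ j, g (p.1 j) < p.2 j} with hA
  have hAm : MeasurableSet A :=
    (hU.preimage measurable_fst).inter (measurableSet_strictMono_and_lt hg m)
  set F : (Fin (m + 1) → E) × (Fin (m + 1) → ℝ) → ℝ≥0∞ :=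
    A.indicator fun p => ENNReal.ofReal (Real.exp (-cumRate ν g (p.2 (Fin.last m)))) with hF
  have hFm : Measurable F :=
    (hS.comp ((measurable_pi_apply _).comp measurable_snd)).indicator hAm
  have h1 := (measurePreserving_arrowProdEquivProdArrow E ℝ (Fin (m + 1)) (fun _ => ν)
    (fun _ => volume)).lintegral_comp hFm
  have hWm : MeasurableSet
      {z : Fin (m + 1) → E × ℝ | (fun j => (z j).1) ∈ U ∧ StrictMono fun j => (z j).2} :=
    (hU.preimage (f := fun (z : Fin (m + 1) → E × ℝ) j => (z j).1) (by fun_prop)).inter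
      (isOpen_setOf_strictMono.measurableSet.preimage
        (f := fun (z : Fin (m + 1) → E × ℝ) j => (z j).2) (by fun_prop))
  have hpi : (Measure.pi fun _ : Fin (m + 1) => heightMeasure ν g) =
      (Measure.pi fun _ : Fin (m + 1) => ν.prod (volume : Measure ℝ)).restrict
        (Set.univ.pi fun _ => {z | g z.1 < z.2}) :=
    (Measure.restrict_pi_pi _ _).symm
  rw [hpi, Measure.restrict_restrict hWm, ← lintegral_indicator
    (hWm.inter (MeasurableSet.univ_pi fun _ => measurableSet_height_lt hg))]
  refine Eq.trans (lintegral_congr fun z => ?_) (h1.trans ?_)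
  · have h : z ∈ {z : Fin (m + 1) → E × ℝ | (fun j => (z j).1) ∈ U ∧ StrictMono fun j => (z j).2} ∩
        (Set.univ.pi fun _ => {z | g z.1 < z.2}) ↔
        MeasurableEquiv.arrowProdEquivProdArrow E ℝ (Fin (m + 1)) z ∈ A := by
      rw [Set.mem_inter_iff, Set.mem_univ_pi, Set.mem_ofPred_eq, and_assoc]
      rfl
    exact indicator_eq_indicator_of_iff h rfl
  · rw [lintegral_prod _ hFm.aemeasurable, ← lintegral_indicator hU]
    refine lintegral_congr fun x => ?_
    by_cases hx : x ∈ U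
    · rw [Set.indicator_of_mem hx, heightKernel, ← lintegral_indicator
        (measurableSet_strictMono_and_lt_section hg x)]
      refine lintegral_congr fun r => ?_
      simp only [hF, hA, Set.indicator, Set.mem_ofPred_eq, hx, true_and]
    · rw [Set.indicator_of_notMem hx]
      simp [hF, hA, hx]

theorem lintegral_heightKernel (hg : Measurable g) (hB : ∀ y, |g y| ≤ B)
    (hν : 0 < ν.real Set.univ) (m : ℕ) :
    ∫⁻ x : Fin (m + 1) → E, heightKernel ν g x ∂(Measure.pi fun _ => ν) = 1 := by
  rw [← lintegral_pi_heightMeasure_eq_one hg hB hν m, ← setLIntegral_univ,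
    ← setLIntegral_pi_heightMeasure hg hB MeasurableSet.univ]
  simp

theorem integrableOn_exp_neg_cumRate (hg : Measurable g) (hB : ∀ y, |g y| ≤ B)
    (hν : 0 < ν.real Set.univ) (a : ℝ) :
    IntegrableOn (fun t => Real.exp (-cumRate ν g t)) (Set.Ioi a) := by
  refine Integrable.mono' ((exp_neg_integrableOn_Ioi a hν).const_mul
    (Real.exp (ν.real Set.univ * B)))
    (Real.continuous_exp.comp (continuous_cumRate hg hB).neg).aestronglyMeasurable
    (Eventually.of_forall fun t => ?_)
  rw [Real.norm_of_nonneg (Real.exp_pos _).le, ← Real.exp_add]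
  refine Real.exp_le_exp.2 ?_
  have := le_cumRate (ν := ν) hg hB t
  linarith

theorem ofReal_integral_Ioi_exp_neg_cumRate (hg : Measurable g) (hB : ∀ y, |g y| ≤ B)
    (hν : 0 < ν.real Set.univ) (a : ℝ) :
    ENNReal.ofReal (∫ t in Set.Ioi a, Real.exp (-cumRate ν g t)) =
      ∫⁻ t in Set.Ioi a, ENNReal.ofReal (Real.exp (-cumRate ν g t)) :=
  ofReal_integral_eq_lintegral_ofReal (integrableOn_exp_neg_cumRate hg hB hν a)
    (Eventually.of_forall fun _ => (Real.exp_pos _).le)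

theorem heightKernel_zero (hg : Measurable g) (hB : ∀ y, |g y| ≤ B)
    (hν : 0 < ν.real Set.univ) (x : Fin 1 → E) :
    heightKernel ν g x = ENNReal.ofReal (∫ t in Set.Ioi (g (x 0)), Real.exp (-cumRate ν g t)) := by
  have hS := measurable_ofReal_exp_neg_cumRate (ν := ν) hg hB
  rw [ofReal_integral_Ioi_exp_neg_cumRate hg hB hν, heightKernel,
    ← lintegral_indicator measurableSet_Ioi, ← lintegral_indicator
    (measurableSet_strictMono_and_lt_section hg x)]
  refine Eq.trans (lintegral_congr fun r => ?_)
    ((volume_preserving_funUnique (Fin 1) ℝ).lintegral_comp (hS.indicator measurableSet_Ioi))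
  have h : (StrictMono r ∧ ∀ j, g (x j) < r j) ↔ g (x 0) < r 0 := by
    refine ⟨fun h => h.2 0, fun h => ⟨fun a b hab =>
      absurd (Subsingleton.elim (α := Fin 1) a b) hab.ne, fun j => ?_⟩⟩
    rwa [Subsingleton.elim (α := Fin 1) j 0]
  exact indicator_eq_indicator_of_iff h rfl

/-- The top height must exceed both the latency of its own point and the preceding height.
Integrating it out gives a tail integral starting at that maximum, which is the shape of Φ. -/
theorem heightKernel_succ (hg : Measurable g) (hB : ∀ y, |g y| ≤ B)
    (hν : 0 < ν.real Set.univ) {m : ℕ} (x : Fin (m + 2) → E) :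
    heightKernel ν g x =
      ∫⁻ r in {r : Fin (m + 1) → ℝ | StrictMono r ∧ ∀ j, g (x j.castSucc) < r j},
        ENNReal.ofReal (∫ t in Set.Ioi (max (g (x (Fin.last (m + 1)))) (r (Fin.last m))),
          Real.exp (-cumRate ν g t)) := by
  have hS := measurable_ofReal_exp_neg_cumRate (ν := ν) hg hB
  set A : Set (ℝ × (Fin (m + 1) → ℝ)) := {p | (StrictMono p.2 ∧ ∀ j, g (x j.castSucc) < p.2 j) ∧
    max (g (x (Fin.last (m + 1)))) (p.2 (Fin.last m)) < p.1} with hA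
  have hm1 : MeasurableSet {r : Fin (m + 1) → ℝ | StrictMono r ∧ ∀ j, g (x j.castSucc) < r j} :=
    measurableSet_strictMono_and_lt_section hg fun j : Fin (m + 1) => x j.castSucc
  have hAm : MeasurableSet A := by
    refine (hm1.preimage measurable_snd).inter ?_
    have : MeasurableSet {p : ℝ × (Fin (m + 1) → ℝ) |
        max (g (x (Fin.last (m + 1)))) (p.2 (Fin.last m)) < p.1} :=
      measurableSet_lt (by fun_prop) (by fun_prop)
    exact this
  have hFm : Measurable (A.indicator fun p => ENNReal.ofReal (Real.exp (-cumRate ν g p.1))) :=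
    (hS.comp measurable_fst).indicator hAm
  have h1 := (volume_preserving_piFinSuccAbove (fun _ : Fin (m + 2) => ℝ)
      (Fin.last (m + 1))).lintegral_comp hFm
  rw [heightKernel, ← lintegral_indicator
    (measurableSet_strictMono_and_lt_section hg x)]
  refine Eq.trans (lintegral_congr fun r => ?_) (h1.trans ?_)
  · have heq : MeasurableEquiv.piFinSuccAbove (fun _ : Fin (m + 2) => ℝ) (Fin.last (m + 1)) r
        = (r (Fin.last (m + 1)), fun j => r j.castSucc) := by
      ext <;> simp [MeasurableEquiv.piFinSuccAbove, Fin.init]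
    rw [heq]
    have h : (StrictMono r ∧ ∀ j, g (x j) < r j) ↔
        (((StrictMono fun j : Fin (m + 1) => r j.castSucc) ∧
          ∀ j : Fin (m + 1), g (x j.castSucc) < r j.castSucc) ∧
        max (g (x (Fin.last (m + 1)))) (r (Fin.last m).castSucc) < r (Fin.last (m + 1))) := by
      rw [strictMono_fin_succ_iff, Fin.forall_fin_succ', max_lt_iff]
      tauto
    exact indicator_eq_indicator_of_iff h rfl
  · rw [Measure.volume_eq_prod, lintegral_prod_symm _ hFm.aemeasurable, ← lintegral_indicator hm1]
    refine lintegral_congr fun r => ?_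
    by_cases hr : StrictMono r ∧ ∀ j, g (x j.castSucc) < r j
    · rw [Set.indicator_of_mem (show r ∈ {r : Fin (m + 1) → ℝ | StrictMono r ∧
        ∀ j, g (x j.castSucc) < r j} from hr), ofReal_integral_Ioi_exp_neg_cumRate hg hB hν,
        ← lintegral_indicator measurableSet_Ioi]
      refine lintegral_congr fun t => ?_
      simp only [hA, Set.indicator, Set.mem_ofPred_eq, hr, Set.mem_Ioi]
      simp
    · rw [Set.indicator_of_notMem (show r ∉ {r : Fin (m + 1) → ℝ | StrictMono r ∧
        ∀ j, g (x j.castSucc) < r j} from hr)]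
      simp [hA, hr]

end LimitKernel

/-! ### The explicit density as an integral over heights -/

section Density

variable {E : Type*} [MeasureSpace E] {D : Set E} {κ g G : E → ℝ} {B : ℝ}

/-- The measure `κ(x) dx` on `D`. -/
noncomputable def rateMeasure (D : Set E) (κ : E → ℝ) : Measure E :=
  (volume.restrict D).withDensity fun y => ENNReal.ofReal (κ y)

theorem rateMeasure_real (hκ : IntegrableOn κ D) (hκ0 : ∀ y ∈ D, 0 ≤ κ y) (hD : MeasurableSet D)
    {A : Set E} (hA : MeasurableSet A) :
    (rateMeasure D κ).real A = ∫ y in D ∩ A, κ y := by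
  rw [measureReal_def, rateMeasure, withDensity_apply _ hA, Measure.restrict_restrict hA,
    Set.inter_comm, integral_eq_lintegral_of_nonneg_ae _
    (hκ.mono_set Set.inter_subset_left).aestronglyMeasurable]
  exact (ae_restrict_iff' (hD.inter hA)).2 (Eventually.of_forall fun y hy => hκ0 y hy.1)

theorem isFiniteMeasure_rateMeasure (hκ : IntegrableOn κ D) :
    IsFiniteMeasure (rateMeasure D κ) := by
  refine ⟨?_⟩
  rw [rateMeasure, withDensity_apply _ MeasurableSet.univ, Measure.restrict_univ]
  exact hκ.lintegral_lt_top

theorem totalRate_eq (hκ : IntegrableOn κ D) (hκ0 : ∀ y ∈ D, 0 ≤ κ y) (hD : MeasurableSet D) :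
    totalRate D κ = (rateMeasure D κ).real Set.univ := by
  rw [rateMeasure_real hκ hκ0 hD MeasurableSet.univ, Set.inter_univ, totalRate]

/-- The total rate cancels the normalisation of the distribution function. The function `H` is a
globally measurable substitute for `h`, whose values outside `D` are irrelevant. -/
theorem survival_eq (hκ : IntegrableOn κ D) (hκ0 : ∀ y ∈ D, 0 ≤ κ y) (hD : MeasurableSet D)
    (hpos : 0 < (rateMeasure D κ).real Set.univ) {h H : E → ℝ} (hH : Measurable H)
    (hB : ∀ y, -B ≤ H y) (hhH : ∀ y ∈ D, h y = H y) (t : ℝ) :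
    survival D κ h t = Real.exp (-cumRate (rateMeasure D κ) H t) := by
  have := isFiniteMeasure_rateMeasure hκ
  have hl : ∀ s, levelCdf D κ h s =
      1 / totalRate D κ * (rateMeasure D κ).real {y | H y ≤ s} := by
    intro s
    rw [levelCdf, rateProb, rateMeasure_real hκ hκ0 hD (measurableSet_le hH measurable_const)]
    congr 2
    have : {x | x ∈ D ∧ h x ≤ s} = D ∩ {y | H y ≤ s} := by
      ext y
      simp only [Set.mem_ofPred_eq, Set.mem_inter_iff]
      exact and_congr_right fun hy => by rw [hhH y hy]
    rw [this]
  rw [survival]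
  simp only [hl]
  rw [integral_const_mul, (integral_Iic_measureReal_le hH hB t).2, totalRate_eq hκ hκ0 hD]
  congr 1
  field_simp

/-- For r ≤ t, pointwise (t - r - (G - r)^+)^+ = (t - G)^+ - (r - G)^+. Thus restarting at height
`r` with shifted latencies leaves the increment of the cumulative rate. -/
theorem cumRate_shiftPos {E : Type*} [MeasurableSpace E] {ν : Measure E} [IsFiniteMeasure ν]
    {G : E → ℝ} {B : ℝ} (hG : Measurable G) (hB : ∀ y, |G y| ≤ B) {r t : ℝ} (hrt : r ≤ t) :
    cumRate ν (shiftPos G r) (t - r) = cumRate ν G t - cumRate ν G r := by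
  rw [cumRate, cumRate, cumRate, ← integral_sub (integrable_max_sub hG hB t)
    (integrable_max_sub hG hB r)]
  refine integral_congr_ae (Eventually.of_forall fun y => ?_)
  simp only [shiftPos]
  grind

theorem survival_shiftPos (hκ : IntegrableOn κ D) (hκ0 : ∀ y ∈ D, 0 ≤ κ y) (hD : MeasurableSet D)
    (hpos : 0 < (rateMeasure D κ).real Set.univ) (hG : Measurable G) (hB : ∀ y, |G y| ≤ B)
    (hgG : ∀ y ∈ D, g y = G y) {r t : ℝ} (hrt : r ≤ t) :
    survival D κ (shiftPos g r) (t - r) =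
      Real.exp (cumRate (rateMeasure D κ) G r - cumRate (rateMeasure D κ) G t) := by
  have := isFiniteMeasure_rateMeasure hκ
  rw [survival_eq (B := 0) (H := shiftPos G r) hκ hκ0 hD hpos
    (by unfold shiftPos; fun_prop) (fun y => by simp [shiftPos])
    (fun y hy => by simp [shiftPos, hgG y hy]), cumRate_shiftPos hG hB hrt, neg_sub]

open Classical in
theorem Psi_shiftPos (hκ : IntegrableOn κ D) (hκ0 : ∀ y ∈ D, 0 ≤ κ y) (hD : MeasurableSet D)
    (hpos : 0 < (rateMeasure D κ).real Set.univ) (hG : Measurable G) (hB : ∀ y, |G y| ≤ B)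
    (hgG : ∀ y ∈ D, g y = G y) (z : E) (r t : ℝ) :
    Psi D κ z (t - r) (shiftPos g r) = if g z < t ∧ r < t then
      Real.exp (cumRate (rateMeasure D κ) G r - cumRate (rateMeasure D κ) G t) else 0 := by
  have hiff : shiftPos g r z < t - r ↔ g z < t ∧ r < t := by
    simp only [shiftPos, max_lt_iff, sub_lt_sub_iff_right, sub_pos]
  unfold Psi
  by_cases h : g z < t ∧ r < t
  · rw [if_pos h, if_pos (hiff.2 h), survival_shiftPos hκ hκ0 hD hpos hG hB hgG h.2.le]
  · rw [if_neg h, if_neg (mt hiff.1 h)]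

/-- Translation of the integration variable by `r`. The prefactor is what remains of conditioning on
height `r`, and cancels in the product with the factors Ψ. -/
theorem Phi_shiftPos (hκ : IntegrableOn κ D) (hκ0 : ∀ y ∈ D, 0 ≤ κ y) (hD : MeasurableSet D)
    (hpos : 0 < (rateMeasure D κ).real Set.univ) (hG : Measurable G) (hB : ∀ y, |G y| ≤ B)
    (hgG : ∀ y ∈ D, g y = G y) (z : E) (r : ℝ) :
    Phi D κ z (shiftPos g r) = Real.exp (cumRate (rateMeasure D κ) G r) *
      ∫ t in Set.Ioi (max (g z) r), Real.exp (-cumRate (rateMeasure D κ) G t) := by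
  have h1 := (measurePreserving_add_right volume r).setIntegral_preimage_emb
    (measurableEmbedding_addRight r) (fun t => Real.exp (cumRate (rateMeasure D κ) G r) *
      Real.exp (-cumRate (rateMeasure D κ) G t)) (Set.Ioi (max (g z) r))
  rw [← integral_const_mul, ← h1, Phi]
  have hset : (fun t => t + r) ⁻¹' Set.Ioi (max (g z) r) = Set.Ioi (shiftPos g r z) := by
    ext t
    simp only [Set.mem_preimage, Set.mem_Ioi, shiftPos]
    grind
  rw [hset]
  refine setIntegral_congr_fun measurableSet_Ioi fun t ht => ?_
  have ht0 : 0 < t := lt_of_le_of_lt (le_max_right (g z - r) 0) ht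
  have h2 := survival_shiftPos hκ hκ0 hD hpos hG hB hgG (r := r) (t := t + r) (by linarith)
  rw [add_sub_cancel_right] at h2
  simp only [h2, ← Real.exp_add, sub_eq_add_neg]

theorem sum_succ_sub_castSucc {l : ℕ} (a : Fin (l + 1) → ℝ) :
    ∑ j : Fin l, (a j.castSucc - a j.succ) = a 0 - a (Fin.last l) := by
  induction l with
  | zero => simp
  | succ l ih =>
    rw [Fin.sum_univ_castSucc]
    have := ih fun j => a j.castSucc
    simp only [← Fin.succ_castSucc] at this ⊢
    rw [this]
    simp

/-- The exponents of the factors Ψ are decrements of Λ between consecutive heights and telescope;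
together with the first factor and the prefactor of Φ they multiply to one. The cut-offs in Ψ say
exactly that the heights increase and exceed the latencies. -/
theorem argminKernel_succ_succ (hκ : IntegrableOn κ D) (hκ0 : ∀ y ∈ D, 0 ≤ κ y)
    (hD : MeasurableSet D) (hpos : 0 < (rateMeasure D κ).real Set.univ) (hG : Measurable G)
    (hB : ∀ y, |G y| ≤ B) (hgG : ∀ y ∈ D, g y = G y) {l : ℕ} (x : Fin (l + 2) → E)
    (r : Fin (l + 1) → ℝ) :
    Phi D κ (x (Fin.last (l + 1))) (shiftPos g (r (Fin.last l))) *
      Psi D κ (x 0) (r 0) g *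
      ∏ j : Fin l, Psi D κ (x j.succ.castSucc) (r j.succ - r j.castSucc)
        (shiftPos g (r j.castSucc)) =
    {r : Fin (l + 1) → ℝ | StrictMono r ∧ ∀ j, g (x j.castSucc) < r j}.indicator
      (fun r => ∫ t in Set.Ioi (max (g (x (Fin.last (l + 1)))) (r (Fin.last l))),
        Real.exp (-cumRate (rateMeasure D κ) G t)) r := by
  classical
  set Λ := cumRate (rateMeasure D κ) G with hΛ
  rw [Phi_shiftPos hκ hκ0 hD hpos hG hB hgG]
  simp only [Psi_shiftPos hκ hκ0 hD hpos hG hB hgG]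
  have hsurv : survival D κ g (r 0) = Real.exp (-Λ (r 0)) :=
    survival_eq hκ hκ0 hD hpos hG (fun y => (abs_le.1 (hB y)).1) hgG _
  by_cases hr : StrictMono r ∧ ∀ j, g (x j.castSucc) < r j
  · rw [Set.indicator_of_mem (show r ∈ {r : Fin (l + 1) → ℝ | StrictMono r ∧
      ∀ j, g (x j.castSucc) < r j} from hr)]
    have h0 : g (x 0) < r 0 := by simpa using hr.2 0
    have h1 : ∀ j : Fin l, g (x j.succ.castSucc) < r j.succ ∧ r j.castSucc < r j.succ :=
      fun j => ⟨hr.2 j.succ, hr.1 j.castSucc_lt_succ⟩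
    simp only [Psi, h0, h1, and_self, if_true, hsurv]
    rw [← Real.exp_sum, sum_succ_sub_castSucc fun j => Λ (r j), ← hΛ]
    have h2 : Real.exp (Λ (r (Fin.last l))) * Real.exp (-Λ (r 0)) *
        Real.exp (Λ (r 0) - Λ (r (Fin.last l))) = 1 := by
      rw [← Real.exp_add, ← Real.exp_add, ← Real.exp_zero]
      congr 1
      ring
    linear_combination (∫ t in Set.Ioi (max (g (x (Fin.last (l + 1)))) (r (Fin.last l))),
      Real.exp (-Λ t)) * h2
  · rw [Set.indicator_of_notMem (show r ∉ {r : Fin (l + 1) → ℝ | StrictMono r ∧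
      ∀ j, g (x j.castSucc) < r j} from hr)]
    rw [Fin.strictMono_iff_lt_succ, Fin.forall_fin_succ] at hr
    by_cases h0 : g (x 0) < r 0
    · have : ∃ j : Fin l, ¬ (g (x j.succ.castSucc) < r j.succ ∧ r j.castSucc < r j.succ) := by
        by_contra hcon
        push Not at hcon
        exact hr ⟨fun i => (hcon i).2, by simpa using h0, fun i => (hcon i).1⟩
      obtain ⟨j, hj⟩ := this
      rw [Finset.prod_eq_zero (Finset.mem_univ j) (if_neg hj), mul_zero]
    · simp [Psi, h0]

/-- The kernel of the explicit density is the integral over heights. -/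
theorem argminKernel_eq_toReal (hκ : IntegrableOn κ D) (hκ0 : ∀ y ∈ D, 0 ≤ κ y)
    (hD : MeasurableSet D) (hpos : 0 < (rateMeasure D κ).real Set.univ) (hG : Measurable G)
    (hB : ∀ y, |G y| ≤ B) (hgG : ∀ y ∈ D, g y = G y) {m : ℕ} {x : Fin (m + 1) → E}
    (hx : ∀ j, x j ∈ D) :
    argminKernel D κ g (m + 1) x = (heightKernel (rateMeasure D κ) G x).toReal := by
  have := isFiniteMeasure_rateMeasure hκ
  set Λ := cumRate (rateMeasure D κ) G with hΛ
  have htail : ∀ a, 0 ≤ ∫ t in Set.Ioi a, Real.exp (-Λ t) := fun a =>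
    integral_nonneg fun t => (Real.exp_pos _).le
  cases m with
  | zero =>
    rw [heightKernel_zero hG hB hpos, ENNReal.toReal_ofReal (htail _)]
    change Phi D κ (x 0) g = _
    rw [Phi, hgG _ (hx 0)]
    exact setIntegral_congr_fun measurableSet_Ioi fun t _ =>
      survival_eq hκ hκ0 hD hpos hG (fun y => (abs_le.1 (hB y)).1) hgG _
  | succ l =>
    have hm := measurableSet_strictMono_and_lt_section hG fun j : Fin (l + 1) => x j.castSucc
    -- Monotonicity of the tail integral serves only to make it measurable.
    have hanti : Antitone fun a => ∫ t in Set.Ioi a, Real.exp (-Λ t) := fun a b hab =>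
      setIntegral_mono_set (integrableOn_exp_neg_cumRate hG hB hpos a)
        (Eventually.of_forall fun t => (Real.exp_pos _).le)
        (Set.Ioi_subset_Ioi hab).eventuallyLE
    rw [heightKernel_succ hG hB hpos]
    change ∫ r : Fin (l + 1) → ℝ, Phi D κ (x (Fin.last (l + 1))) (shiftPos g (r (Fin.last l))) *
      Psi D κ (x 0) (r 0) g * ∏ j : Fin l, Psi D κ (x j.succ.castSucc) (r j.succ - r j.castSucc)
        (shiftPos g (r j.castSucc)) = _
    simp only [argminKernel_succ_succ hκ hκ0 hD hpos hG hB hgG, hgG _ (hx _)]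
    rw [integral_indicator hm, integral_eq_lintegral_of_nonneg_ae
      (Eventually.of_forall fun r => htail _)]
    exact (hanti.measurable.comp (by fun_prop : Measurable fun r : Fin (l + 1) → ℝ =>
      max (G (x (Fin.last (l + 1)))) (r (Fin.last l)))).aestronglyMeasurable

end Density

section Law

variable {E : Type*} [MeasureSpace E] [SigmaFinite (volume : Measure E)] {D : Set E}
  {κ g G : E → ℝ} {B : ℝ}

/-- The law with the explicit density has density `heightKernel` with respect to the product of
copies of `κ(x) dx`. -/
theorem argminLaw_eq_withDensity (hκ : IntegrableOn κ D) (hκ0 : ∀ y ∈ D, 0 ≤ κ y)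
    (hD : MeasurableSet D) (hpos : 0 < (rateMeasure D κ).real Set.univ) (hG : Measurable G)
    (hB : ∀ y, |G y| ≤ B) (hgG : ∀ y ∈ D, g y = G y) (m : ℕ) :
    argminLaw D κ g (m + 1) = (Measure.pi fun _ : Fin (m + 1) => rateMeasure D κ).withDensity
      fun x => heightKernel (rateMeasure D κ) G x := by
  have hfin := isFiniteMeasure_rateMeasure hκ
  have hK := measurable_heightKernel (ν := rateMeasure D κ) hG hB m
  have hκm : AEMeasurable (fun y => ENNReal.ofReal (κ y)) (volume.restrict D) :=
    hκ.aemeasurable.ennreal_ofReal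
  have hpm : AEMeasurable (fun x : Fin (m + 1) → E => ∏ j, ENNReal.ofReal (κ (x j)))
      (Measure.pi fun _ => volume.restrict D) :=
    Finset.aemeasurable_fun_prod _ fun j _ =>
      hκm.comp_quasiMeasurePreserving (Measure.quasiMeasurePreserving_eval _ j)
  have hsf : SigmaFinite ((volume.restrict D).withDensity fun y => ENNReal.ofReal (κ y)) :=
    inferInstanceAs (SigmaFinite (rateMeasure D κ))
  have hpi : (Measure.pi fun _ : Fin (m + 1) => rateMeasure D κ) =
      (Measure.pi fun _ : Fin (m + 1) => volume.restrict D).withDensity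
        fun x => ∏ j, ENNReal.ofReal (κ (x j)) := pi_withDensity hκm
  -- The kernel integrates to one, hence is finite almost everywhere, so passing through `toReal`
  -- loses nothing. Where the product of rates vanishes this says nothing, but there both densities
  -- are zero.
  have hlt : ∀ᵐ x ∂(Measure.pi fun _ : Fin (m + 1) => rateMeasure D κ),
      heightKernel (rateMeasure D κ) G x < ∞ :=
    ae_lt_top hK (by rw [lintegral_heightKernel hG hB hpos]; exact ENNReal.one_ne_top)
  rw [hpi, ae_withDensity_iff' hpm] at hlt
  rw [hpi, ← withDensity_mul₀ hpm hK.aemeasurable, argminLaw, volume_pi, Measure.restrict_pi_pi]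
  refine withDensity_congr_ae ?_
  have hmem : ∀ᵐ x ∂(Measure.pi fun _ : Fin (m + 1) => (volume : Measure E).restrict D),
      ∀ j, x j ∈ D := ae_all_iff.2 fun j =>
    (Measure.quasiMeasurePreserving_eval _ j).ae (ae_restrict_mem hD)
  filter_upwards [hlt, hmem] with x hx1 hx2
  rw [argminDensity, argminKernel_eq_toReal hκ hκ0 hD hpos hG hB hgG hx2, Pi.mul_apply,
    ENNReal.ofReal_mul (Finset.prod_nonneg fun j _ => hκ0 _ (hx2 j)),
    ENNReal.ofReal_prod_of_nonneg fun j _ => hκ0 _ (hx2 j)]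
  by_cases h : ∏ j, ENNReal.ofReal (κ (x j)) = 0
  · rw [h, zero_mul, zero_mul]
  · rw [ENNReal.ofReal_toReal (hx1 h).ne]

theorem isProbabilityMeasure_argminLaw (hκ : IntegrableOn κ D) (hκ0 : ∀ y ∈ D, 0 ≤ κ y)
    (hD : MeasurableSet D) (hpos : 0 < (rateMeasure D κ).real Set.univ) (hG : Measurable G)
    (hB : ∀ y, |G y| ≤ B) (hgG : ∀ y ∈ D, g y = G y) (m : ℕ) :
    IsProbabilityMeasure (argminLaw D κ g (m + 1)) := by
  have hfin := isFiniteMeasure_rateMeasure hκ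
  refine ⟨?_⟩
  rw [argminLaw_eq_withDensity hκ hκ0 hD hpos hG hB hgG, withDensity_apply _ MeasurableSet.univ,
    Measure.restrict_univ, lintegral_heightKernel hG hB hpos]

/-- The law of the first argmins as an integral over points and heights. -/
theorem argminLaw_apply (hκ : IntegrableOn κ D) (hκ0 : ∀ y ∈ D, 0 ≤ κ y)
    (hD : MeasurableSet D) (hpos : 0 < (rateMeasure D κ).real Set.univ) (hG : Measurable G)
    (hB : ∀ y, |G y| ≤ B) (hgG : ∀ y ∈ D, g y = G y) {m : ℕ} {U : Set (Fin (m + 1) → E)}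
    (hU : MeasurableSet U) :
    argminLaw D κ g (m + 1) U =
    ∫⁻ z in {z : Fin (m + 1) → E × ℝ | (fun j => (z j).1) ∈ U ∧ StrictMono fun j => (z j).2},
      ENNReal.ofReal (Real.exp (-cumRate (rateMeasure D κ) G (z (Fin.last m)).2))
      ∂(Measure.pi fun _ => heightMeasure (rateMeasure D κ) G) := by
  have hfin := isFiniteMeasure_rateMeasure hκ
  rw [setLIntegral_pi_heightMeasure hG hB hU, argminLaw_eq_withDensity hκ hκ0 hD hpos hG hB hgG,
    withDensity_apply _ hU]

end Law

/-! ### Asymptotics of the heights -/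

section Heights

variable {Ω : Type*} [MeasurableSpace Ω] {P : Measure Ω} [IsProbabilityMeasure P]
  {ξ : ℕ → Ω → ℝ} {l γ : ℕ → ℝ} {b c : ℝ}

/-- The height of the `i`-th point among `n` points with rates `l` and latencies `γ`. -/
noncomputable def pointHeight (ξ : ℕ → Ω → ℝ) (l γ : ℕ → ℝ) (n i : ℕ) (ω : Ω) : ℝ :=
  n / l i * ξ i ω + γ i

/-- The average cumulative rate of the first `n` points. -/
noncomputable def averageRate (l γ : ℕ → ℝ) (n : ℕ) (t : ℝ) : ℝ :=
  (1 / (n : ℝ)) * ∑ i ∈ Finset.range n, l i * max (t - γ i) 0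

theorem measurable_pointHeight (hξ : ∀ i, Measurable (ξ i)) (n i : ℕ) :
    Measurable (pointHeight ξ l γ n i) :=
  ((hξ i).const_mul _).add_const _

theorem rate_mul_le (hl : ∀ i, 0 < l i) (hb : ∀ i, l i ≤ b) (hc : ∀ i, |γ i| ≤ c) {R t : ℝ}
    (ht : t ≤ R) (i : ℕ) : l i * max (t - γ i) 0 ≤ b * (|R| + c) := by
  have h1 := abs_le.1 (hc i)
  have h2 : max (t - γ i) 0 ≤ |R| + c :=
    max_le (by linarith [le_abs_self R]) (by linarith [abs_nonneg R, (abs_nonneg _).trans (hc i)])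
  exact mul_le_mul (hb i) h2 (le_max_right _ _) ((hl i).le.trans (hb i))

/-- The height is at most `t` iff `ξ i` is at most `l i * (t - γ i) / n`. For `t ≥ γ i` this
threshold is nonnegative and O(1/n) uniformly in `i`, so the expansion of the distribution function
applies with error O(1/n²); for `t < γ i` it is negative and the probability is zero. -/
theorem exists_abs_measureReal_pointHeight_sub_le (hξ : ∀ i, Measurable (ξ i))
    (hξ0 : ∀ i, ∀ᵐ ω ∂P, 0 ≤ ξ i ω)
    (hcdf : ∃ C > (0 : ℝ), ∃ δ > (0 : ℝ), ∀ i, ∀ t ∈ Set.Icc 0 δ,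
      |cdf (P.map (ξ i)) t - t| ≤ C * t ^ 2)
    (hl : ∀ i, 0 < l i) (hb : ∀ i, l i ≤ b) (hc : ∀ i, |γ i| ≤ c) (R : ℝ) :
    ∃ K, 0 ≤ K ∧ ∀ᶠ n : ℕ in atTop, ∀ i, ∀ t ≤ R,
      |P.real {ω | pointHeight ξ l γ n i ω ≤ t} - l i * max (t - γ i) 0 / n| ≤ K / (n : ℝ) ^ 2 := by
  obtain ⟨C, hC, δ, hδ, hcdf⟩ := hcdf
  refine ⟨C * (b * (|R| + c)) ^ 2, by positivity, ?_⟩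
  have hlim : Tendsto (fun n : ℕ => b * (|R| + c) / (n : ℝ)) atTop (𝓝 0) :=
    tendsto_const_div_atTop_nhds_zero_nat _
  filter_upwards [(tendsto_order.1 hlim).2 δ hδ, eventually_gt_atTop 0] with n hn hn0 i t ht
  have hn0' : (0 : ℝ) < n := Nat.cast_pos.2 hn0
  have hset : {ω | pointHeight ξ l γ n i ω ≤ t} = {ω | ξ i ω ≤ l i * (t - γ i) / n} := by
    ext ω
    simp only [pointHeight, Set.mem_ofPred_eq]
    rw [← le_sub_iff_add_le, div_mul_eq_mul_div, div_le_iff₀ (hl i), le_div_iff₀ hn0',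
      mul_comm (n : ℝ), mul_comm (l i)]
  rw [hset]
  have hub := rate_mul_le hl hb hc ht i
  rcases lt_or_ge t (γ i) with h | h
  · have hneg : l i * (t - γ i) / n < 0 :=
      div_neg_of_neg_of_pos (mul_neg_of_pos_of_neg (hl i) (by linarith)) hn0'
    have h0 : P.real {ω | ξ i ω ≤ l i * (t - γ i) / n} = 0 := by
      rw [measureReal_def, ENNReal.toReal_eq_zero_iff]
      left
      refine measure_mono_null (fun ω hω => ?_) (ae_iff.1 (hξ0 i))
      exact not_le.2 (lt_of_le_of_lt hω hneg)
    rw [h0, max_eq_right (by linarith)]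
    simp only [mul_zero, zero_div, sub_zero, abs_zero]
    positivity
  · rw [max_eq_left (by linarith)] at hub ⊢
    have hpr : IsProbabilityMeasure (P.map (ξ i)) :=
      Measure.isProbabilityMeasure_map (hξ i).aemeasurable
    have hcd : P.real {ω | ξ i ω ≤ l i * (t - γ i) / n} =
        cdf (P.map (ξ i)) (l i * (t - γ i) / n) := by
      rw [cdf_eq_real, map_measureReal_apply (hξ i) measurableSet_Iic]
      rfl
    have hnn : 0 ≤ l i * (t - γ i) / n :=
      div_nonneg (mul_nonneg (hl i).le (by linarith)) hn0'.le
    have hle : l i * (t - γ i) / n ≤ b * (|R| + c) / n := by gcongr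
    rw [hcd]
    refine (hcdf i _ ⟨hnn, hle.trans hn.le⟩).trans ?_
    calc C * (l i * (t - γ i) / n) ^ 2 ≤ C * (b * (|R| + c) / n) ^ 2 :=
          mul_le_mul_of_nonneg_left (pow_le_pow_left₀ hnn hle 2) hC.le
      _ = C * (b * (|R| + c)) ^ 2 / (n : ℝ) ^ 2 := by ring

/-- From `1 + y ≤ exp y` at `y = p / (1 - p)`; the condition `p ≤ 1 / 2` bounds this `y` by `p + 2 *
p ^ 2`. -/
theorem exp_le_one_sub {p : ℝ} (h1 : p ≤ 1 / 2) :
    Real.exp (-(p + 2 * p ^ 2)) ≤ 1 - p := by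
  have h2 : p / (1 - p) ≤ p + 2 * p ^ 2 := by
    rw [div_le_iff₀ (by linarith)]
    nlinarith [mul_nonneg (sq_nonneg p) (by linarith : 0 ≤ 1 - 2 * p)]
  have h3 : (1 - p)⁻¹ ≤ Real.exp (p + 2 * p ^ 2) := by
    refine le_trans ?_ (Real.exp_le_exp.2 h2)
    refine le_trans (le_of_eq ?_) (Real.add_one_le_exp _)
    field_simp [(by linarith : (1 - p) ≠ 0)]
    ring
  rw [Real.exp_neg]
  exact inv_le_of_inv_le₀ (by linarith) h3

theorem exists_le_prod_measure_pointHeight (hξ : ∀ i, Measurable (ξ i))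
    (hξ0 : ∀ i, ∀ᵐ ω ∂P, 0 ≤ ξ i ω)
    (hcdf : ∃ C > (0 : ℝ), ∃ δ > (0 : ℝ), ∀ i, ∀ t ∈ Set.Icc 0 δ,
      |cdf (P.map (ξ i)) t - t| ≤ C * t ^ 2)
    (hl : ∀ i, 0 < l i) (hb : ∀ i, l i ≤ b) (hc : ∀ i, |γ i| ≤ c) (R : ℝ) :
    ∃ K, ∀ᶠ n : ℕ in atTop, ∀ t ≤ R,
      ENNReal.ofReal (Real.exp (-(averageRate l γ n t + K / n))) ≤
        ∏ i : Fin n, P {ω | t < pointHeight ξ l γ n i ω} := by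
  obtain ⟨K, hK0, hK⟩ :=
    exists_abs_measureReal_pointHeight_sub_le (P := P) hξ hξ0 hcdf hl hb hc R
  set u : ℝ := b * (|R| + c) with hu
  have hu0 : 0 ≤ u := (mul_nonneg (hl 0).le (le_max_right _ _)).trans (rate_mul_le hl hb hc le_rfl 0)
  -- `K` is the error of the single probabilities, and each of these is at most `(u + K) / n`, so
  -- the quadratic terms contribute `2 * (u + K) ^ 2`. Summing n errors of order 1/n² leaves order
  -- 1/n.
  refine ⟨K + 2 * (u + K) ^ 2, ?_⟩
  have hlim : Tendsto (fun n : ℕ => (u + K) / (n : ℝ)) atTop (𝓝 0) :=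
    tendsto_const_div_atTop_nhds_zero_nat _
  filter_upwards [hK, (tendsto_order.1 hlim).2 (1 / 2) (by norm_num), eventually_ge_atTop 1]
    with n hn hn2 hn1 t ht
  have hn1' : (1 : ℝ) ≤ n := by exact_mod_cast hn1
  have hn0 : (0 : ℝ) < n := by linarith
  set p : ℕ → ℝ := fun i => P.real {ω | pointHeight ξ l γ n i ω ≤ t} with hp
  have hple : ∀ i, p i ≤ l i * max (t - γ i) 0 / n + K / (n : ℝ) ^ 2 := fun i => by
    have := (abs_le.1 (hn i t ht)).2
    simp only [hp]; linarith
  have hple2 : ∀ i, p i ≤ (u + K) / n := fun i => by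
    have h1 : l i * max (t - γ i) 0 / n ≤ u / n := by
      gcongr
      exact rate_mul_le hl hb hc ht i
    have h2 : K / (n : ℝ) ^ 2 ≤ K / n := by
      gcongr
      nlinarith
    have := hple i
    rw [add_div]
    linarith
  have hp0 : ∀ i, 0 ≤ p i := fun i => measureReal_nonneg
  have hprob : ∀ i, P {ω | t < pointHeight ξ l γ n i ω} = ENNReal.ofReal (1 - p i) := by
    intro i
    have hm : MeasurableSet {ω | pointHeight ξ l γ n i ω ≤ t} :=
      measurableSet_le (measurable_pointHeight hξ n i) measurable_const
    have hcompl : {ω | t < pointHeight ξ l γ n i ω} = {ω | pointHeight ξ l γ n i ω ≤ t}ᶜ := by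
      ext ω; simp
    rw [hcompl, ← ofReal_measureReal, measureReal_compl hm]
    simp [hp]
  simp only [hprob]
  rw [← ENNReal.ofReal_prod_of_nonneg fun i _ => by linarith [hple2 i]]
  refine ENNReal.ofReal_le_ofReal ?_
  have hstep : ∏ i : Fin n, Real.exp (-(p i + 2 * p i ^ 2)) ≤ ∏ i : Fin n, (1 - p i) :=
    Finset.prod_le_prod (fun i _ => (Real.exp_pos _).le) fun i _ =>
      exp_le_one_sub ((hple2 i).trans hn2.le)
  refine le_trans ?_ hstep
  rw [← Real.exp_sum]
  refine Real.exp_le_exp.2 ?_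
  rw [Finset.sum_neg_distrib, neg_le_neg_iff,
    Fin.sum_univ_eq_sum_range (fun i => p i + 2 * p i ^ 2) n]
  have hterm : ∀ i ∈ Finset.range n, p i + 2 * p i ^ 2 ≤
      l i * max (t - γ i) 0 / n + (K + 2 * (u + K) ^ 2) / (n : ℝ) ^ 2 := by
    intro i _
    have h1 : p i ^ 2 ≤ ((u + K) / n) ^ 2 := pow_le_pow_left₀ (hp0 i) (hple2 i) 2
    have h2 := hple i
    rw [div_pow] at h1
    have h3 : (K + 2 * (u + K) ^ 2) / (n : ℝ) ^ 2 =
      K / (n : ℝ) ^ 2 + 2 * ((u + K) ^ 2 / (n : ℝ) ^ 2) := by ring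
    rw [h3]
    linarith
  refine (Finset.sum_le_sum hterm).trans (le_of_eq ?_)
  rw [Finset.sum_add_distrib, averageRate, Finset.sum_const, Finset.card_range, nsmul_eq_mul,
    ← Finset.sum_div]
  field_simp

theorem averageRate_mono (hl : ∀ i, 0 < l i) (n : ℕ) : Monotone (averageRate l γ n) := by
  intro s t hst
  refine mul_le_mul_of_nonneg_left (Finset.sum_le_sum fun i _ => ?_) (by positivity)
  exact mul_le_mul_of_nonneg_left (max_le_max_right 0 (by linarith)) (hl i).le

theorem averageRate_eq_zero (hc : ∀ i, |γ i| ≤ c) (n : ℕ) {t : ℝ} (ht : t ≤ -c) :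
    averageRate l γ n t = 0 := by
  have : ∀ i, max (t - γ i) 0 = 0 := fun i => max_eq_right (by linarith [(abs_le.1 (hc i)).1])
  simp [averageRate, this]

/-- Monotone functions converging pointwise to a continuous function are eventually uniformly not
much larger, on compact sets. -/
theorem eventually_forall_le_add_of_monotone {f : ℕ → ℝ → ℝ} {F : ℝ → ℝ}
    (hf : ∀ n, Monotone (f n)) (hF : Continuous F)
    (hlim : ∀ t, Tendsto (fun n => f n t) atTop (𝓝 (F t))) {s : Set ℝ} (hs : IsCompact s) {ε : ℝ}
    (hε : 0 < ε) : ∀ᶠ n in atTop, ∀ t ∈ s, f n t ≤ F t + ε := by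
  refine hs.induction_on (p := fun s => ∀ᶠ n in atTop, ∀ t ∈ s, f n t ≤ F t + ε) (by simp)
    (fun s s' hss h => h.mono fun n hn t ht => hn t (hss ht))
    (fun s s' h h' => by
      filter_upwards [h, h'] with n hn hn' t ht
      exact ht.elim (hn t) (hn' t)) fun t₀ _ => ?_
  -- Near `t₀`, monotonicity bounds `f n t` by `f n t₁`, so convergence at the single point `t₁`
  -- controls a whole neighbourhood.
  obtain ⟨t₁, ht₁, ht₁F⟩ : ∃ t₁ > t₀, F t₁ < F t₀ + ε / 3 := by
    have h := (hF.tendsto t₀).eventually (gt_mem_nhds (show F t₀ < F t₀ + ε / 3 by linarith))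
    have h2 : ∀ᶠ t in 𝓝[>] t₀, F t < F t₀ + ε / 3 ∧ t₀ < t :=
      (h.filter_mono nhdsWithin_le_nhds).and self_mem_nhdsWithin
    obtain ⟨t, h1, h2⟩ := h2.exists
    exact ⟨t, h2, h1⟩
  refine ⟨{t | F t₀ - ε / 3 < F t} ∩ Set.Iio t₁, mem_nhdsWithin_of_mem_nhds (inter_mem
    ((hF.tendsto t₀).eventually (lt_mem_nhds (by linarith))) (Iio_mem_nhds ht₁)), ?_⟩
  filter_upwards [(tendsto_order.1 (hlim t₁)).2 (F t₁ + ε / 3) (by linarith)] with n hn t ht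
  have h1 : F t₀ - ε / 3 < F t := ht.1
  have h2 := hf n (le_of_lt (show t < t₁ from ht.2))
  linarith

/-- The probability that no height is below `t` is asymptotically at least `exp (-Λ t)`, uniformly
in `t` bounded above. -/
theorem eventually_le_prod_measure_pointHeight (hξ : ∀ i, Measurable (ξ i))
    (hξ0 : ∀ i, ∀ᵐ ω ∂P, 0 ≤ ξ i ω)
    (hcdf : ∃ C > (0 : ℝ), ∃ δ > (0 : ℝ), ∀ i, ∀ t ∈ Set.Icc 0 δ,
      |cdf (P.map (ξ i)) t - t| ≤ C * t ^ 2)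
    (hl : ∀ i, 0 < l i) (hb : ∀ i, l i ≤ b) (hc : ∀ i, |γ i| ≤ c) {Λ : ℝ → ℝ}
    (hΛ : Continuous Λ) (hΛ0 : ∀ t, 0 ≤ Λ t)
    (hlim : ∀ t, Tendsto (fun n => averageRate l γ n t) atTop (𝓝 (Λ t))) (R : ℝ) {ε : ℝ}
    (hε : 0 < ε) :
    ∀ᶠ n : ℕ in atTop, ∀ t ≤ R,
      ENNReal.ofReal (Real.exp (-ε)) * ENNReal.ofReal (Real.exp (-Λ t)) ≤
        ∏ i : Fin n, P {ω | t < pointHeight ξ l γ n i ω} := by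
  obtain ⟨K, hK⟩ := exists_le_prod_measure_pointHeight (P := P) hξ hξ0 hcdf hl hb hc R
  have hlim2 : Tendsto (fun n : ℕ => K / (n : ℝ)) atTop (𝓝 0) :=
    tendsto_const_div_atTop_nhds_zero_nat _
  filter_upwards [hK, (tendsto_order.1 hlim2).2 (ε / 2) (by linarith),
    eventually_forall_le_add_of_monotone (averageRate_mono hl) hΛ hlim
      (isCompact_Icc (a := -c) (b := R)) (half_pos hε)] with n h1 h2 h3 t ht
  refine le_trans ?_ (h1 t ht)
  rw [← ENNReal.ofReal_mul (Real.exp_pos _).le, ← Real.exp_add]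
  refine ENNReal.ofReal_le_ofReal (Real.exp_le_exp.2 ?_)
  -- Below `-c` the average rate vanishes, so uniformity on the compact interval `[-c, R]` is
  -- enough.
  have h4 : averageRate l γ n t ≤ Λ t + ε / 2 := by
    rcases le_total t (-c) with h | h
    · rw [averageRate_eq_zero hc n h]
      linarith [hΛ0 t]
    · exact h3 t ⟨h, ht⟩
  linarith

end Heights

/-! ### Convergence of the point measures -/

theorem integral_rateMeasure {E : Type*} [MeasureSpace E] {D : Set E} {κ : E → ℝ}
    (hκ : IntegrableOn κ D) (hκ0 : ∀ y ∈ D, 0 ≤ κ y) (hD : MeasurableSet D) (f : E → ℝ) :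
    ∫ y, f y ∂(rateMeasure D κ) = ∫ y in D, κ y * f y := by
  rw [rateMeasure, integral_withDensity_eq_integral_toReal_smul₀ hκ.aemeasurable.ennreal_ofReal
    (Eventually.of_forall fun _ => ENNReal.ofReal_lt_top)]
  refine setIntegral_congr_fun hD fun y hy => ?_
  simp only [ENNReal.toReal_ofReal (hκ0 y hy), smul_eq_mul]

theorem integral_rateMeasure_mul {E : Type*} [MeasureSpace E] {D : Set E} {lam ρ L : E → ℝ}
    (hρ : IntegrableOn ρ D) (hκ : IntegrableOn (fun y => lam y * ρ y) D) (hρ0 : ∀ y ∈ D, 0 ≤ ρ y)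
    (hL0 : ∀ y, 0 ≤ L y) (hL : ∀ y ∈ D, lam y = L y) (hD : MeasurableSet D) (f : E → ℝ) :
    ∫ y, f y ∂(rateMeasure D fun y => lam y * ρ y) = ∫ y, L y * f y ∂(rateMeasure D ρ) := by
  rw [integral_rateMeasure hκ (fun y hy => mul_nonneg (by rw [hL y hy]; exact hL0 y) (hρ0 y hy)) hD,
    integral_rateMeasure hρ hρ0 hD]
  refine setIntegral_congr_fun hD fun y hy => ?_
  simp only [hL y hy]
  ring

theorem heightMeasure_prod_Iic {E : Type*} [MeasurableSpace E] {ν : Measure E} [IsFiniteMeasure ν]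
    {G : E → ℝ} {B : ℝ} (hG : Measurable G) (hB : ∀ y, |G y| ≤ B) (A : Set E) (b : ℝ) :
    heightMeasure ν G (A ×ˢ Set.Iic b) ≠ ∞ ∧ (MeasurableSet A →
      (heightMeasure ν G).real (A ×ˢ Set.Iic b) = ∫ y in A, max (b - G y) 0 ∂ν) := by
  have key : ∀ A : Set E, MeasurableSet A → heightMeasure ν G (A ×ˢ Set.Iic b) =
      ENNReal.ofReal (∫ y in A, max (b - G y) 0 ∂ν) := by
    intro A hA
    rw [heightMeasure, Measure.restrict_apply (hA.prod measurableSet_Iic),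
      Measure.prod_apply ((hA.prod measurableSet_Iic).inter (measurableSet_height_lt hG)),
      ofReal_integral_eq_lintegral_ofReal (integrable_max_sub hG hB b).integrableOn
        (Eventually.of_forall fun y => le_max_right _ _), ← lintegral_indicator hA]
    refine lintegral_congr fun y => ?_
    by_cases hy : y ∈ A
    · rw [Set.indicator_of_mem hy, ENNReal.ofReal_max, ENNReal.ofReal_zero,
        max_eq_left (by simp), ← Real.volume_Ioc]
      congr 1
      ext t
      simp [hy, and_comm]
    · rw [Set.indicator_of_notMem hy]
      have : Prod.mk y ⁻¹' (A ×ˢ Set.Iic b ∩ {z : E × ℝ | G z.1 < z.2}) = ∅ := by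
        ext t
        simp [hy]
      rw [this, measure_empty]
  refine ⟨?_, fun hA => ?_⟩
  · refine ne_top_of_le_ne_top ?_ (measure_mono (Set.prod_mono_left (Set.subset_univ A)))
    rw [key _ MeasurableSet.univ]
    exact ENNReal.ofReal_ne_top
  · rw [measureReal_def, key A hA]
    exact ENNReal.toReal_ofReal (integral_nonneg fun y => le_max_right (b - G y) 0)

section PointMeasure

variable {E Ω : Type*} [PseudoMetricSpace E] [MeasureSpace E] [BorelSpace E] [MeasurableSpace Ω]
  {P : Measure Ω} [IsProbabilityMeasure P] {ξ : ℕ → Ω → ℝ} {D : Set E} {lam ρ g : E → ℝ}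
  {L G : E →ᵇ ℝ} {x : ℕ → E}

/-- The intensity measure of the first `n` points together with their heights. -/
noncomputable def pointMeasure (P : Measure Ω) (ξ : ℕ → Ω → ℝ) (l γ : ℕ → ℝ) (x : ℕ → E) (n : ℕ) :
    Measure (E × ℝ) :=
  ∑ i : Fin n, P.map fun ω => (x i, pointHeight ξ l γ n i ω)

instance (l γ : ℕ → ℝ) (n : ℕ) : IsFiniteMeasure (pointMeasure P ξ l γ x n) := by
  unfold pointMeasure; infer_instance

theorem tendsto_average_rate_indicator (hD : MeasurableSet D) (hρ : IntegrableOn ρ D)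
    (hρ0 : ∀ y ∈ D, 0 ≤ ρ y) (hκ : IntegrableOn (fun y => lam y * ρ y) D)
    (hL0 : ∀ y, 0 ≤ L y) (hL : ∀ y ∈ D, lam y = L y)
    (hx : ∀ φ : E →ᵇ ℝ, Tendsto (fun n : ℕ => (1 / (n : ℝ)) * ∑ i ∈ Finset.range n, φ (x i)) atTop
      (𝓝 (∫ y in D, φ y * ρ y)))
    {A : Set E} (hA : MeasurableSet A) (hA' : rateMeasure D ρ (frontier A) = 0) (b : ℝ) :
    Tendsto (fun n : ℕ => (1 / (n : ℝ)) * ∑ i ∈ Finset.range n,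
        A.indicator (fun y => L y * max (b - G y) 0) (x i)) atTop
      (𝓝 (∫ y in A, max (b - G y) 0 ∂(rateMeasure D fun y => lam y * ρ y))) := by
  have hfin := isFiniteMeasure_rateMeasure hρ
  have hcont : Continuous fun y => L y * max (b - G y) 0 := by fun_prop
  set h : E →ᵇ ℝ := BoundedContinuousFunction.ofNormedAddCommGroup
    (fun y => L y * max (b - G y) 0) hcont (‖L‖ * (|b| + ‖G‖)) (fun y => by
      rw [norm_mul]
      refine mul_le_mul (L.norm_coe_le_norm y) ?_ (norm_nonneg _) (norm_nonneg _)
      rw [Real.norm_of_nonneg (le_max_right _ _)]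
      have := abs_le.1 (G.norm_coe_le_norm y)
      exact max_le (by linarith [le_abs_self b]) (by positivity)) with hh
  have hx' : ∀ φ : E →ᵇ ℝ, Tendsto (fun n : ℕ => (1 / (n : ℝ)) * ∑ i ∈ Finset.range n, φ (x i))
      atTop (𝓝 (∫ y, φ y ∂(rateMeasure D ρ))) := by
    intro φ
    rw [integral_rateMeasure hρ hρ0 hD]
    simpa only [mul_comm] using hx φ
  have h1 := tendsto_average_indicator hx' (h := h)
    (fun y => mul_nonneg (hL0 y) (le_max_right _ _)) hA hA'
  have h2 : ∫ y in A, h y ∂(rateMeasure D ρ) =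
      ∫ y in A, max (b - G y) 0 ∂(rateMeasure D fun y => lam y * ρ y) := by
    rw [← integral_indicator hA, ← integral_indicator hA,
      integral_rateMeasure_mul hρ hκ hρ0 hL0 hL hD]
    refine integral_congr_ae (Eventually.of_forall fun y => ?_)
    by_cases hy : y ∈ A <;> simp [hy, hh]
  rw [← h2]
  exact h1

/-- Each of the n probabilities differs from its share of the weighted empirical average by at most
K/n², so the total error is K/n, and the average converges on continuity sets. -/
theorem tendsto_pointMeasure_prod_Iic (hξ : ∀ i, Measurable (ξ i))
    (hξ0 : ∀ i, ∀ᵐ ω ∂P, 0 ≤ ξ i ω)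
    (hcdf : ∃ C > (0 : ℝ), ∃ δ > (0 : ℝ), ∀ i, ∀ t ∈ Set.Icc 0 δ,
      |cdf (P.map (ξ i)) t - t| ≤ C * t ^ 2)
    (hD : MeasurableSet D) (hρ : IntegrableOn ρ D) (hρ0 : ∀ y ∈ D, 0 ≤ ρ y)
    (hκ : IntegrableOn (fun y => lam y * ρ y) D)
    (hL0 : ∀ y, 0 ≤ L y) (hL : ∀ y ∈ D, lam y = L y) (hlam : ∀ y ∈ D, 0 < lam y)
    (hG : ∀ y ∈ D, g y = G y) (hxD : ∀ i, x i ∈ D)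
    (hx : ∀ φ : E →ᵇ ℝ, Tendsto (fun n : ℕ => (1 / (n : ℝ)) * ∑ i ∈ Finset.range n, φ (x i)) atTop
      (𝓝 (∫ y in D, φ y * ρ y)))
    {A : Set E} (hA : MeasurableSet A) (hA' : rateMeasure D ρ (frontier A) = 0) (b : ℝ) :
    Tendsto (fun n : ℕ => (pointMeasure P ξ (fun i => lam (x i)) (fun i => g (x i)) x n).real
        (A ×ˢ Set.Iic b)) atTop
      (𝓝 ((heightMeasure (rateMeasure D fun y => lam y * ρ y) G).real (A ×ˢ Set.Iic b))) := by
  have hfin := isFiniteMeasure_rateMeasure hκ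
  set l : ℕ → ℝ := fun i => lam (x i) with hl
  set γ : ℕ → ℝ := fun i => g (x i) with hγ
  have hGB : ∀ y, |G y| ≤ ‖G‖ := fun y => G.norm_coe_le_norm y
  obtain ⟨K, hK0, hK⟩ := exists_abs_measureReal_pointHeight_sub_le (P := P) (l := l) (γ := γ)
    (b := ‖L‖) (c := ‖G‖) hξ hξ0 hcdf (fun i => hlam _ (hxD i))
    (fun i => by simp only [hl, hL _ (hxD i)]; exact (le_abs_self _).trans (L.norm_coe_le_norm _))
    (fun i => by simp only [hγ, hG _ (hxD i)]; exact hGB _) b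
  rw [(heightMeasure_prod_Iic G.continuous.measurable hGB A b).2 hA]
  have h1 := tendsto_average_rate_indicator (G := G) hD hρ hρ0 hκ hL0 hL hx hA hA' b
  refine tendsto_of_tendsto_of_dist h1 ?_
  have hlim : Tendsto (fun n : ℕ => K / (n : ℝ)) atTop (𝓝 0) :=
    tendsto_const_div_atTop_nhds_zero_nat _
  refine squeeze_zero' (Eventually.of_forall fun n => dist_nonneg) ?_ hlim
  filter_upwards [hK, eventually_gt_atTop 0] with n hn hn0
  have hn0' : (0 : ℝ) < n := Nat.cast_pos.2 hn0
  have hreal : (pointMeasure P ξ l γ x n).real (A ×ˢ Set.Iic b) = ∑ i ∈ Finset.range n,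
      A.indicator (fun _ => P.real {ω | pointHeight ξ l γ n i ω ≤ b}) (x i) := by
    rw [← Fin.sum_univ_eq_sum_range
      (fun i => A.indicator (fun _ => P.real {ω | pointHeight ξ l γ n i ω ≤ b}) (x i)),
      measureReal_def, pointMeasure, Measure.finsetSum_apply,
      ENNReal.toReal_sum fun i _ => measure_ne_top _ _]
    refine Finset.sum_congr rfl fun i _ => ?_
    rw [Measure.map_apply (measurable_const.prodMk (measurable_pointHeight hξ n i))
      (hA.prod measurableSet_Iic)]
    by_cases hy : x i ∈ A
    · rw [Set.indicator_of_mem hy, measureReal_def]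
      congr 2
      ext ω
      simp [hy]
    · rw [Set.indicator_of_notMem hy]
      have : (fun ω => (x i, pointHeight ξ l γ n i ω)) ⁻¹' A ×ˢ Set.Iic b = ∅ := by
        ext ω
        simp [hy]
      rw [this, measure_empty, ENNReal.toReal_zero]
  rw [hreal, Real.dist_eq, Finset.mul_sum, ← Finset.sum_sub_distrib]
  refine (Finset.abs_sum_le_sum_abs _ _).trans ?_
  have hterm : ∀ i ∈ Finset.range n,
      |1 / (n : ℝ) * A.indicator (fun y => L y * max (b - G y) 0) (x i) -
        A.indicator (fun _ => P.real {ω | pointHeight ξ l γ n i ω ≤ b}) (x i)| ≤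
        K / (n : ℝ) ^ 2 := by
    intro i _
    by_cases hy : x i ∈ A
    · rw [Set.indicator_of_mem hy, Set.indicator_of_mem hy, abs_sub_comm, one_div_mul_eq_div,
        ← hL _ (hxD i), ← hG _ (hxD i)]
      exact hn i b le_rfl
    · rw [Set.indicator_of_notMem hy, Set.indicator_of_notMem hy]
      simp only [mul_zero, sub_zero, abs_zero]
      positivity
  refine (Finset.sum_le_sum hterm).trans (le_of_eq ?_)
  rw [Finset.sum_const, Finset.card_range, nsmul_eq_mul]
  field_simp

end PointMeasure

/-! ### Asymptotic lower bounds for the law of the lowest points -/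

theorem lowestEvent_mono {α Ω : Type*} {n m : ℕ} {h : α → ℝ} {Z : Fin n → Ω → α}
    {W W' : Set (Fin (m + 1) → α)} (hW : W ⊆ W') (f : Fin (m + 1) → Fin n) :
    lowestEvent h Z W f ⊆ lowestEvent h Z W' f :=
  fun _ hω => ⟨hW hω.1, hω.2⟩

section LowerBound

variable {E Ω : Type*} [PseudoMetricSpace E] [SecondCountableTopology E] [MeasureSpace E]
  [BorelSpace E] [MeasurableSingletonClass E] [MeasurableSpace Ω]
  {P : Measure Ω} [IsProbabilityMeasure P] {ξ : ℕ → Ω → ℝ} {D : Set E} {lam ρ g : E → ℝ}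
  {L G : E →ᵇ ℝ} {x : ℕ → E}

/-- Lower bounds for powers of the mean measure on open sets are combined with the lower bound for
survival. The latter is uniform only for heights bounded above, so heights are first cut off at `N`,
and the cut-off is removed by monotone convergence. -/
theorem setLIntegral_le_liminf_lowestEvent (hξ : ∀ i, Measurable (ξ i)) (hind : iIndepFun ξ P)
    (hξ0 : ∀ i, ∀ᵐ ω ∂P, 0 ≤ ξ i ω)
    (hcdf : ∃ C > (0 : ℝ), ∃ δ > (0 : ℝ), ∀ i, ∀ t ∈ Set.Icc 0 δ,
      |cdf (P.map (ξ i)) t - t| ≤ C * t ^ 2)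
    (hD : MeasurableSet D) (hρ : IntegrableOn ρ D) (hρ0 : ∀ y ∈ D, 0 ≤ ρ y)
    (hκ : IntegrableOn (fun y => lam y * ρ y) D)
    (hL0 : ∀ y, 0 ≤ L y) (hL : ∀ y ∈ D, lam y = L y) (hlam : ∀ y ∈ D, 0 < lam y)
    (hG : ∀ y ∈ D, g y = G y) (hxD : ∀ i, x i ∈ D)
    (hx : ∀ φ : E →ᵇ ℝ, Tendsto (fun n : ℕ => (1 / (n : ℝ)) * ∑ i ∈ Finset.range n, φ (x i)) atTop
      (𝓝 (∫ y in D, φ y * ρ y)))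
    {m : ℕ} {U : Set (Fin (m + 1) → E)} (hU : IsOpen U)
    (hUinj : ∀ y ∈ U, Function.Injective y) :
    ∫⁻ z in {z : Fin (m + 1) → E × ℝ | (fun j => (z j).1) ∈ U ∧ StrictMono fun j => (z j).2},
      ENNReal.ofReal (Real.exp (-cumRate (rateMeasure D fun y => lam y * ρ y) G
        (z (Fin.last m)).2))
      ∂(Measure.pi fun _ => heightMeasure (rateMeasure D fun y => lam y * ρ y) G) ≤
    liminf (fun n : ℕ => P (⋃ f : Fin (m + 1) → Fin n, lowestEvent Prod.snd
      (fun (i : Fin n) ω => (x i, pointHeight ξ (fun i => lam (x i)) (fun i => g (x i)) n i ω))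
      {z | (fun j => (z j).1) ∈ U ∧ StrictMono fun j => (z j).2} f)) atTop := by
  have hfin := isFiniteMeasure_rateMeasure hκ
  have hfinρ := isFiniteMeasure_rateMeasure hρ
  set l : ℕ → ℝ := fun i => lam (x i) with hl
  set γ : ℕ → ℝ := fun i => g (x i) with hγ
  set ν := rateMeasure D fun y => lam y * ρ y with hν
  set Λ := cumRate ν G with hΛ
  have hGm : Measurable G := G.continuous.measurable
  have hGB : ∀ y, |G y| ≤ ‖G‖ := fun y => G.norm_coe_le_norm y
  have hΛc : Continuous Λ := continuous_cumRate hGm hGB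
  have hSc : Continuous fun z : Fin (m + 1) → E × ℝ => Real.exp (-Λ (z (Fin.last m)).2) := by
    fun_prop
  set W : Set (Fin (m + 1) → E × ℝ) :=
    {z | (fun j => (z j).1) ∈ U ∧ StrictMono fun j => (z j).2} with hW
  have hWo : IsOpen W :=
    (hU.preimage (f := fun (z : Fin (m + 1) → E × ℝ) j => (z j).1) (by fun_prop)).inter
      (isOpen_setOf_strictMono.preimage
        (f := fun (z : Fin (m + 1) → E × ℝ) j => (z j).2) (by fun_prop))
  set V : ℕ → Set (Fin (m + 1) → E × ℝ) := fun N => W ∩ {z | (z (Fin.last m)).2 < N} with hV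
  have hVo : ∀ N, IsOpen (V N) := fun N =>
    hWo.inter (isOpen_lt (by fun_prop) continuous_const)
  have hVmono : Monotone V := fun N N' h z hz =>
    ⟨hz.1, lt_of_lt_of_le (b := (N : ℝ)) hz.2 (by exact_mod_cast h)⟩
  have hVunion : ⋃ N, V N = W := by
    ext z
    simp only [Set.mem_iUnion]
    exact ⟨fun ⟨N, h⟩ => h.1, fun h => (exists_nat_gt (z (Fin.last m)).2).imp fun N hN => ⟨h, hN⟩⟩
  set M : Measure (Fin (m + 1) → E × ℝ) := Measure.pi fun _ => heightMeasure ν G with hM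
  set Mn : ℕ → Measure (Fin (m + 1) → E × ℝ) := fun n =>
    Measure.pi fun _ => pointMeasure P ξ l γ x n with hMn
  have hopen : ∀ O : Set (Fin (m + 1) → E × ℝ), IsOpen O →
      M O ≤ liminf (fun n => Mn n O) atTop := by
    intro O hO
    refine pi_measure_le_liminf (rateMeasure D ρ) (fun n A b => measure_ne_top _ _)
      (fun A b => (heightMeasure_prod_Iic hGm hGB A b).1) (fun A hA hA' b => ?_) hO
    exact tendsto_pointMeasure_prod_Iic hξ hξ0 hcdf hD hρ hρ0 hκ hL0 hL hlam hG hxD hx hA hA' b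
  have havg : ∀ t, Tendsto (fun n => averageRate l γ n t) atTop (𝓝 (Λ t)) := by
    intro t
    have h := tendsto_average_rate_indicator (G := G) hD hρ hρ0 hκ hL0 hL hx MeasurableSet.univ
      (by simp) t
    simp only [Set.indicator_univ, Measure.restrict_univ] at h
    refine h.congr fun n => ?_
    simp only [averageRate, hl, hγ, hL _ (hxD _), hG _ (hxD _)]
  have hTind : ∀ n, iIndepFun (fun (i : Fin n) => pointHeight ξ l γ n i) P := fun n =>
    (hind.precomp (g := fun i : Fin n => (i : ℕ)) Fin.val_injective).comp
      (fun i t => n / l i * t + γ i) fun i => by fun_prop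
  have hbound : ∀ (N : ℕ) (ε : ℝ), 0 < ε → ENNReal.ofReal (Real.exp (-ε)) *
      ∫⁻ z in V N, ENNReal.ofReal (Real.exp (-Λ (z (Fin.last m)).2)) ∂M ≤
      liminf (fun n : ℕ => P (⋃ f : Fin (m + 1) → Fin n, lowestEvent Prod.snd
        (fun (i : Fin n) ω => (x i, pointHeight ξ l γ n i ω)) W f)) atTop := by
    intro N ε hε
    -- Asymptotic lower bounds on open sets pass to integrals of nonnegative continuous functions;
    -- they survive restriction to `V N` because it is open.
    have h1 : ∫⁻ z in V N, ENNReal.ofReal (Real.exp (-Λ (z (Fin.last m)).2)) ∂M ≤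
        liminf (fun n => ∫⁻ z in V N, ENNReal.ofReal (Real.exp (-Λ (z (Fin.last m)).2)) ∂(Mn n))
          atTop := by
      refine lintegral_le_liminf_lintegral_of_forall_isOpen_measure_le_liminf_measure hSc
        (fun z => (Real.exp_pos _).le) fun O hO => ?_
      simp only [Measure.restrict_apply hO.measurableSet]
      exact hopen _ (hO.inter (hVo N))
    refine (mul_le_mul_right h1 _).trans ?_
    rw [← ENNReal.liminf_const_mul_of_ne_top ENNReal.ofReal_ne_top]
    refine liminf_le_liminf ?_ (by isBoundedDefault) (by isBoundedDefault)
    filter_upwards [eventually_le_prod_measure_pointHeight (P := P) (l := l) (γ := γ)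
      (b := ‖L‖) (c := ‖G‖) hξ hξ0 hcdf (fun i => hlam _ (hxD i))
      (fun i => by simp only [hl, hL _ (hxD i)]; exact (le_abs_self _).trans (L.norm_coe_le_norm _))
      (fun i => by simp only [hγ, hG _ (hxD i)]; exact hGB _) hΛc
      (fun t => integral_nonneg fun y => le_max_right (t - G y) 0) havg N hε] with n hn
    rw [← lintegral_const_mul' _ _ ENNReal.ofReal_ne_top]
    have h2 := setLIntegral_prod_le_iUnion_lowestEvent (x := fun i : Fin n => x i)
      (T := fun (i : Fin n) => pointHeight ξ l γ n i) (fun i => measurable_pointHeight hξ n i)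
      (hTind n) (hVo N).measurableSet (fun z hz => hUinj _ hz.1.1) fun z hz => hz.1.2
    refine le_trans ?_ (h2.trans (measure_mono (Set.iUnion_mono fun f =>
      lowestEvent_mono Set.inter_subset_left f)))
    refine setLIntegral_mono' (hVo N).measurableSet fun z hz => hn _ (le_of_lt hz.2)
  have hlimV : Tendsto (fun N : ℕ => ∫⁻ z in V N,
      ENNReal.ofReal (Real.exp (-Λ (z (Fin.last m)).2)) ∂M) atTop
      (𝓝 (∫⁻ z in W, ENNReal.ofReal (Real.exp (-Λ (z (Fin.last m)).2)) ∂M)) := by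
    have h := tendsto_measure_iUnion_atTop
      (μ := M.withDensity fun z => ENNReal.ofReal (Real.exp (-Λ (z (Fin.last m)).2))) hVmono
    rw [hVunion] at h
    simpa only [Function.comp_def, withDensity_apply _ (hVo _).measurableSet,
      withDensity_apply _ hWo.measurableSet] using h
  have hlimε : Tendsto (fun N : ℕ => ENNReal.ofReal (Real.exp (-(1 / ((N : ℝ) + 1))))) atTop
      (𝓝 1) := by
    have h := (ENNReal.continuous_ofReal.comp Real.continuous_exp).tendsto (-0)
    simp only [neg_zero, Function.comp_apply, Real.exp_zero, ENNReal.ofReal_one] at h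
    refine h.comp ?_
    simpa using (tendsto_one_div_add_atTop_nhds_zero_nat (𝕜 := ℝ)).neg
  have hprod := ENNReal.Tendsto.mul hlimε (Or.inl one_ne_zero) hlimV (Or.inr ENNReal.one_ne_top)
  rw [one_mul] at hprod
  -- The cut-off `N` and the loss `ε = 1 / (N + 1)` are sent to their limits together.
  exact le_of_tendsto' hprod fun N => hbound N _ (by positivity)

end LowerBound

/-! ### From heights to argmins -/

section Argmins

variable {E Ω : Type*} {K : Set E} {lam g : E → ℝ} {x : ℕ → E} {ξ : ℕ → Ω → ℝ}

theorem kArgminSet_discreteFn_eq_singleton (hx : Function.Injective x) (hxK : ∀ i, x i ∈ K)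
    {n m : ℕ} {f : Fin (m + 1) → Fin n} {ω : Ω} {W : Set (Fin (m + 1) → E × ℝ)}
    (hW : ∀ z ∈ W, StrictMono fun j => (z j).2)
    (hω : ω ∈ lowestEvent Prod.snd (fun (i : Fin n) ω =>
      (x i, pointHeight ξ (fun i => lam (x i)) (fun i => g (x i)) n i ω)) W f)
    (j : Fin (m + 1)) :
    kArgminSet K (discreteFn x lam g n fun i => ξ i ω) j = {x (f j)} := by
  have hval : ∀ i : Fin n, discreteFn x lam g n (fun i => ξ i ω) (x i) =
      ((pointHeight ξ (fun i => lam (x i)) (fun i => g (x i)) n i ω : ℝ) : EReal) := fun i =>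
    discreteFn_apply hx lam g n (fun i => ξ i ω) i.2
  have hmono := hW _ hω.1
  refine kArgminSet_eq_singleton (y := fun j => x (f j)) (fun j => hxK _)
    (fun a b hab => ?_) (fun z hz hne j => ?_) j
  · change discreteFn x lam g n (fun i => ξ i ω) (x (f a)) < discreteFn x lam g n (fun i => ξ i ω) (x (f b))
    rw [hval, hval]
    exact EReal.coe_lt_coe_iff.2 (hmono hab)
  · rw [hval]
    by_cases h : ∃ i : Fin n, x i = z
    · obtain ⟨i, rfl⟩ := h
      rw [hval]
      refine EReal.coe_lt_coe_iff.2 (lt_of_le_of_lt (hmono.monotone (Fin.le_last j))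
        (hω.2 i fun j' hj' => hne j' (by rw [hj'])))
    · rw [discreteFn_eq_top x lam g n _ fun i hi hz => h ⟨⟨i, hi⟩, hz⟩]
      exact EReal.coe_lt_top _

theorem measurable_kArgmin_discreteFn [Zero E] [MeasurableSpace E] [MeasurableSpace Ω]
    (hx : Function.Injective x) (hxK : ∀ i, x i ∈ K) (hξ : ∀ i, Measurable (ξ i)) (n j : ℕ) :
    Measurable fun ω => kArgmin K (discreteFn x lam g n fun i => ξ i ω) j := by
  classical
  have hnot : ∀ i, n ≤ i → x i ∉ (Finset.range n).image x := by
    intro i hi h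
    obtain ⟨i', hi', h⟩ := Finset.mem_image.1 h
    have := hx h
    simp at hi'
    omega
  -- The points `x n` and `x (n + 1)` are not yet in play at stage `n` and supply the two required
  -- points with value `⊤`.
  refine measurable_kArgmin (s := (Finset.range n).image x) (u := x n) (v := x (n + 1)) ?_ ?_ ?_
    (fun h => by simpa using hx h) ⟨hxK _, hnot n le_rfl⟩ ⟨hxK _, hnot _ (Nat.le_succ n)⟩ j
  · intro z hz
    obtain ⟨i, _, rfl⟩ := Finset.mem_image.1 hz
    exact hxK i
  · intro ω z hz
    refine discreteFn_eq_top x lam g n _ fun i hi h => hz ?_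
    exact Finset.mem_image.2 ⟨i, Finset.mem_range.2 hi, h⟩
  · intro z
    unfold discreteFn
    refine Measurable.iInf fun i => Measurable.iInf fun _ => ?_
    exact measurable_coe_real_ereal.comp (((hξ i).const_mul _).add_const _)

end Argmins

/-! ### Continuous extensions and null diagonals -/

/-- Tietze extension. It makes the rate and the latency admissible in the weak convergence
hypothesis, whose test functions live on the whole space. -/
theorem exists_boundedContinuous_eqOn {E : Type*} [TopologicalSpace E] [NormalSpace E] {s : Set E}
    (hs : IsCompact s) (hs' : IsClosed s) {f : E → ℝ} (hf : ContinuousOn f s) :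
    ∃ F : E →ᵇ ℝ, ∀ y ∈ s, f y = F y := by
  have : CompactSpace s := isCompact_iff_compactSpace.1 hs
  obtain ⟨F, -, hF⟩ := BoundedContinuousFunction.exists_extension_norm_eq_of_isClosedEmbedding
    (BoundedContinuousFunction.mkOfCompact ⟨s.domRestrict f, hf.domRestrict⟩)
    hs'.isClosedEmbedding_subtypeVal
  exact ⟨F, fun y hy => (congrFun hF ⟨y, hy⟩).symm⟩

theorem isOpen_setOf_injective {E : Type*} [TopologicalSpace E] [T2Space E] {k : ℕ} :
    IsOpen {y : Fin k → E | Function.Injective y} := by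
  have : {y : Fin k → E | Function.Injective y} = ⋂ i, ⋂ j, ⋂ (_ : i ≠ j), {y | y i ≠ y j} := by
    ext y
    simp only [Set.mem_ofPred_eq, Set.mem_iInter]
    exact ⟨fun h i j hij e => hij (h e), fun h i j e => by_contra fun hij => h i j hij e⟩
  rw [this]
  exact isOpen_iInter_of_finite fun i => isOpen_iInter_of_finite fun j =>
    isOpen_iInter_of_finite fun _ => isOpen_ne_fun (continuous_apply i) (continuous_apply j)

theorem volume_setOf_not_injective {E : Type*} [NormedAddCommGroup E] [InnerProductSpace ℝ E]
    [FiniteDimensional ℝ E] [MeasurableSpace E] [BorelSpace E] [Nontrivial E] {k : ℕ} :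
    (volume : Measure (Fin k → E)) {y | ¬ Function.Injective y} = 0 := by
  have hsub : {y : Fin k → E | ¬ Function.Injective y} ⊆
      ⋃ i, ⋃ j, ⋃ (_ : i ≠ j), {y | y i = y j} := by
    intro y hy
    simp only [Set.mem_ofPred_eq, Function.Injective, not_forall] at hy
    obtain ⟨i, j, hij, hne⟩ := hy
    simp only [Set.mem_iUnion]
    exact ⟨i, j, hne, hij⟩
  refine measure_mono_null hsub ?_
  simp only [measure_iUnion_null_iff]
  intro i j hij
  set S : Submodule ℝ (Fin k → E) := LinearMap.ker
    ((LinearMap.proj i : (Fin k → E) →ₗ[ℝ] E) - LinearMap.proj j) with hS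
  have hset : {y : Fin k → E | y i = y j} = S := by
    ext y
    simp [hS, sub_eq_zero]
  rw [hset]
  -- A diagonal is a linear subspace; it is proper, and hence null, because `E` has a nonzero
  -- vector.
  refine Measure.addHaar_submodule _ S fun htop => ?_
  obtain ⟨v, hv⟩ := exists_ne (0 : E)
  have : Pi.single i v ∈ S := htop ▸ Submodule.mem_top
  simp [hS, hij.symm] at this
  exact hv this

theorem argminLaw_setOf_not_injective {E : Type*} [NormedAddCommGroup E] [InnerProductSpace ℝ E]
    [FiniteDimensional ℝ E] [MeasurableSpace E] [BorelSpace E] [Nontrivial E] (D : Set E)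
    (κ g : E → ℝ) (k : ℕ) : argminLaw D κ g k {y | ¬ Function.Injective y} = 0 :=
  withDensity_absolutelyContinuous _ _
    (Measure.absolutelyContinuous_of_le Measure.restrict_le_self volume_setOf_not_injective)

/-! ### Convergence of the first argmins -/

theorem integrableOn_mul_of_eqOn {E : Type*} [TopologicalSpace E] [MeasureSpace E]
    [OpensMeasurableSpace E] {D : Set E} {lam ρ : E → ℝ} {L : E →ᵇ ℝ} (hD : MeasurableSet D)
    (hρ : IntegrableOn ρ D) (hL : ∀ y ∈ D, lam y = L y) :
    IntegrableOn (fun y => lam y * ρ y) D := by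
  have h : IntegrableOn (fun y => L y * ρ y) D :=
    hρ.bdd_mul (c := ‖L‖) L.continuous.aestronglyMeasurable
      (Eventually.of_forall fun y => L.norm_coe_le_norm y)
  exact h.congr_fun (fun y hy => by simp only [hL y hy]) hD

theorem rateMeasure_mul_univ_pos {E : Type*} [MeasureSpace E] {D : Set E} {lam ρ : E → ℝ}
    (hD : MeasurableSet D) (hκ : IntegrableOn (fun y => lam y * ρ y) D)
    (hlam : ∀ y ∈ D, 0 < lam y) (hρ0 : ∀ y ∈ D, 0 ≤ ρ y) (hρ1 : ∫ y in D, ρ y ≠ 0) :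
    0 < (rateMeasure D fun y => lam y * ρ y).real Set.univ := by
  have hκ0 : ∀ y ∈ D, 0 ≤ lam y * ρ y := fun y hy => mul_nonneg (hlam y hy).le (hρ0 y hy)
  rw [rateMeasure_real hκ hκ0 hD MeasurableSet.univ, Set.inter_univ]
  refine lt_of_le_of_ne (setIntegral_nonneg hD hκ0) fun h => hρ1 ?_
  have h0 := (setIntegral_eq_zero_iff_of_nonneg_ae
    ((ae_restrict_iff' hD).2 (Eventually.of_forall hκ0)) hκ).1 h.symm
  refine integral_eq_zero_of_ae ?_
  filter_upwards [h0, ae_restrict_mem hD] with y hy hyD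
  exact (mul_eq_zero.1 hy).resolve_left (hlam y hyD).ne'

/-- The diagonals are closed and null for the limit law, so `U` may be replaced by its open subset
of injective tuples, as the bound for the lowest points requires. -/
theorem argminLaw_le_liminf {E Ω : Type*} [NormedAddCommGroup E] [InnerProductSpace ℝ E]
    [FiniteDimensional ℝ E] [MeasurableSpace E] [BorelSpace E] [Nontrivial E]
    [MeasurableSpace Ω] {P : Measure Ω} [IsProbabilityMeasure P] {ξ : ℕ → Ω → ℝ} {D K : Set E}
    {lam ρ g : E → ℝ} {L G : E →ᵇ ℝ} {x : ℕ → E} (hξ : ∀ i, Measurable (ξ i))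
    (hind : iIndepFun ξ P) (hξ0 : ∀ i, ∀ᵐ ω ∂P, 0 ≤ ξ i ω)
    (hcdf : ∃ C > (0 : ℝ), ∃ δ > (0 : ℝ), ∀ i, ∀ t ∈ Set.Icc 0 δ,
      |cdf (P.map (ξ i)) t - t| ≤ C * t ^ 2)
    (hD : MeasurableSet D) (hρ : IntegrableOn ρ D) (hρ0 : ∀ y ∈ D, 0 ≤ ρ y)
    (hpos : 0 < (rateMeasure D fun y => lam y * ρ y).real Set.univ)
    (hL0 : ∀ y, 0 ≤ L y) (hL : ∀ y ∈ D, lam y = L y) (hlam : ∀ y ∈ D, 0 < lam y)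
    (hG : ∀ y ∈ D, g y = G y) (hxD : ∀ i, x i ∈ D) (hxK : ∀ i, x i ∈ K)
    (hxinj : Function.Injective x)
    (hx : ∀ φ : E →ᵇ ℝ, Tendsto (fun n : ℕ => (1 / (n : ℝ)) * ∑ i ∈ Finset.range n, φ (x i)) atTop
      (𝓝 (∫ y in D, φ y * ρ y)))
    {m : ℕ} {U : Set (Fin (m + 1) → E)} (hU : IsOpen U) :
    argminLaw D (fun y => lam y * ρ y) g (m + 1) U ≤
      liminf (fun n : ℕ => P ({ω | ∀ j : Fin (m + 1), ∃ y,
        kArgminSet K (discreteFn x lam g n fun i => ξ i ω) j = {y}} ∩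
        {ω | (fun j : Fin (m + 1) => kArgmin K (discreteFn x lam g n fun i => ξ i ω) j) ∈ U}))
        atTop := by
  have hκ := integrableOn_mul_of_eqOn hD hρ hL
  have hκ0 : ∀ y ∈ D, 0 ≤ lam y * ρ y := fun y hy => mul_nonneg (hlam y hy).le (hρ0 y hy)
  have hV : IsOpen (U ∩ {y | Function.Injective y}) := hU.inter isOpen_setOf_injective
  rw [← measure_inter_conull (t := {y : Fin (m + 1) → E | Function.Injective y})
    (by exact argminLaw_setOf_not_injective D _ g (m + 1)),
    argminLaw_apply hκ hκ0 hD hpos G.continuous.measurable G.norm_coe_le_norm hG hV.measurableSet]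
  refine (setLIntegral_le_liminf_lowestEvent hξ hind hξ0 hcdf hD hρ hρ0 hκ hL0 hL hlam hG hxD hx
    hV fun y hy => hy.2).trans ?_
  refine liminf_le_liminf (Eventually.of_forall fun n => measure_mono ?_)
    (by isBoundedDefault) (by isBoundedDefault)
  refine Set.iUnion_subset fun f ω hω => ?_
  have hs := kArgminSet_discreteFn_eq_singleton hxinj hxK (fun z hz => hz.2) hω
  refine ⟨fun j => ⟨_, hs j⟩, ?_⟩
  have heq : (fun j : Fin (m + 1) => kArgmin K (discreteFn x lam g n fun i => ξ i ω) j) =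
      fun j => x (f j) := funext fun j =>
    (Set.singleton_injective ((hs j).symm.trans (kArgmin_spec K _ j ⟨_, hs j⟩))).symm
  rw [Set.mem_ofPred_eq, heq]
  exact hω.1.1.1

theorem mainTheorem3 {d : ℕ} (D : Set (EuclideanSpace ℝ (Fin d)))
    (hD_open : IsOpen D) (hD_bdd : Bornology.IsBounded D)
    -- the limiting density of points
    (ρ : EuclideanSpace ℝ (Fin d) → ℝ) (hρ_cont : ContinuousOn ρ D)
    (hρ_nonneg : ∀ y ∈ D, 0 ≤ ρ y) (hρ_mass : ∫ y in D, ρ y = 1)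
    -- the points, whose empirical measures converge weakly to `ρ(y) dy`
    (x : ℕ → EuclideanSpace ℝ (Fin d)) (hx_mem : ∀ i, x i ∈ D) (hx_inj : Function.Injective x)
    (hx_weak : ∀ φ : BoundedContinuousFunction (EuclideanSpace ℝ (Fin d)) ℝ,
      Tendsto (fun n : ℕ => (1 / (n : ℝ)) * ∑ i ∈ Finset.range n, φ (x i)) atTop
        (𝓝 (∫ y in D, φ y * ρ y)))
    -- the rate and the latency
    (lam : EuclideanSpace ℝ (Fin d) → ℝ) (hlam_cont : ContinuousOn lam (closure D))
    (hlam_pos : ∀ y ∈ closure D, 0 < lam y)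
    (g : EuclideanSpace ℝ (Fin d) → ℝ) (hg_cont : ContinuousOn g (closure D))
    -- the independent random variables
    {Ω : Type*} [MeasurableSpace Ω] (P : Measure Ω) [IsProbabilityMeasure P]
    (ξ : ℕ → Ω → ℝ) (hξ_meas : ∀ i, Measurable (ξ i)) (hξ_indep : iIndepFun ξ P)
    (hξ_nonneg : ∀ i, ∀ᵐ ω ∂P, 0 ≤ ξ i ω)
    (hξ_cdf : ∃ C > (0 : ℝ), ∃ δ > (0 : ℝ), ∀ i, ∀ t ∈ Set.Icc 0 δ,
      |cdf (P.map (ξ i)) t - t| ≤ C * t ^ 2)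
    (k : ℕ) (hk : 1 ≤ k) :
    -- with probability tending to one, the first `k` argmins of `f_n` exist and are unique
    Tendsto (fun n : ℕ => P {ω | ∀ j : Fin k, ∃ y,
        kArgminSet (closure D) (discreteFn x lam g n (fun i => ξ i ω)) j = {y}}) atTop (𝓝 1) ∧
    -- the explicit density is a probability density, and the joint law of the argmins
    -- converges weakly to it
    ∃ _ : IsProbabilityMeasure (argminLaw D (fun y => lam y * ρ y) g k),
      TendstoInDistribution
        (fun (n : ℕ) (ω : Ω) (j : Fin k) =>
          kArgmin (closure D) (discreteFn x lam g n (fun i => ξ i ω)) (j : ℕ))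
        atTop (id : (Fin k → EuclideanSpace ℝ (Fin d)) → Fin k → EuclideanSpace ℝ (Fin d))
        (fun _ => P) (argminLaw D (fun y => lam y * ρ y) g k) := by
  have hD := hD_open.measurableSet
  have hxD : ∀ i, x i ∈ closure D := fun i => subset_closure (hx_mem i)
  obtain ⟨L, hL⟩ := exists_boundedContinuous_eqOn hD_bdd.isCompact_closure isClosed_closure
    hlam_cont
  obtain ⟨G, hG⟩ := exists_boundedContinuous_eqOn hD_bdd.isCompact_closure isClosed_closure hg_cont
  replace hG : ∀ y ∈ D, g y = G y := fun y hy => hG y (subset_closure hy)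
  have hlam : ∀ y ∈ D, 0 < lam y := fun y hy => hlam_pos y (subset_closure hy)
  -- Passing to `|L|` keeps the values on `D`, where the rate is positive, and makes the extension
  -- nonnegative everywhere.
  replace hL : ∀ y ∈ D, lam y = |L| y := fun y hy => by
    rw [BoundedContinuousFunction.coe_abs, Pi.abs_apply, ← hL y (subset_closure hy), abs_of_pos (hlam y hy)]
  have hL0 : ∀ y, 0 ≤ |L| y := fun y => abs_nonneg (L y)
  -- Two distinct points exist, so the dimension is not zero.
  have : Nontrivial (EuclideanSpace ℝ (Fin d)) := ⟨x 0, x 1, hx_inj.ne zero_ne_one⟩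
  have hρ1 : ∫ y in D, ρ y ≠ 0 := by rw [hρ_mass]; exact one_ne_zero
  -- The integral of a non-integrable function is zero by convention, so total mass one forces
  -- integrability.
  have hρ : IntegrableOn ρ D := not_imp_comm.1 integral_undef hρ1
  have hκ := integrableOn_mul_of_eqOn hD hρ hL
  have hpos := rateMeasure_mul_univ_pos hD hκ hlam hρ_nonneg hρ1
  obtain ⟨m, rfl⟩ : ∃ m, k = m + 1 := ⟨k - 1, by omega⟩
  have hprob : IsProbabilityMeasure (argminLaw D (fun y => lam y * ρ y) g (m + 1)) :=
    isProbabilityMeasure_argminLaw hκ (fun y hy => mul_nonneg (hlam y hy).le (hρ_nonneg y hy)) hD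
      hpos G.continuous.measurable G.norm_coe_le_norm hG m
  have key : ∀ U : Set (Fin (m + 1) → EuclideanSpace ℝ (Fin d)), IsOpen U →
      argminLaw D (fun y => lam y * ρ y) g (m + 1) U ≤ _ := fun U hU =>
    argminLaw_le_liminf hξ_meas hξ_indep hξ_nonneg hξ_cdf hD hρ hρ_nonneg hpos hL0 hL hlam hG
      hx_mem hxD hx_inj hx_weak hU
  have hmeas : ∀ n, Measurable fun (ω : Ω) (j : Fin (m + 1)) =>
      kArgmin (closure D) (discreteFn x lam g n fun i => ξ i ω) (j : ℕ) := fun n =>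
    measurable_pi_lambda _ fun j => measurable_kArgmin_discreteFn hx_inj hxD hξ_meas n j
  refine ⟨?_, hprob, fun n => (hmeas n).aemeasurable, aemeasurable_id, ?_⟩
  · refine tendsto_of_le_liminf_of_limsup_le ?_ ?_ (by isBoundedDefault) (by isBoundedDefault)
    -- With `U` the whole space the lower bound is the total mass of the limit law, which is one.
    · have h := key Set.univ isOpen_univ
      rw [measure_univ] at h
      exact h.trans (liminf_le_liminf (Eventually.of_forall fun n =>
        measure_mono Set.inter_subset_left) (by isBoundedDefault) (by isBoundedDefault))
    · exact limsup_le_of_le (by isBoundedDefault) (Eventually.of_forall fun n => prob_le_one)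
  · refine tendsto_of_forall_isOpen_le_liminf' fun U hU => ?_
    simp only [ProbabilityMeasure.coe_mk, Measure.map_id,
      Measure.map_apply (hmeas _) hU.measurableSet]
    exact (key U hU).trans (liminf_le_liminf (Eventually.of_forall fun n =>
      measure_mono Set.inter_subset_right) (by isBoundedDefault) (by isBoundedDefault))
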